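/- Let $G$ be a group with identity $e$, generated by a finite non-empty symmetric set $S$ (that is, $g\in S$ implies $g^{-1}\in S$). Let $p=(p_g)_{g\in G}$ be a probability measure on $G$ whose support is finite and generates $G$, and consider the random walk on $G$ with transition probabilities $\mathcal P(g,h)=p_{g^{-1}h}$. A colored random walk on $G\times[r]$, where $[r]=\{1,\dots,r\}$, is a Markov chain with transition probabilities $\tilde{\mathcal P}((g,u),(h,v))=\tilde p_{g^{-1}h}(u,v)$, where $(\tilde p_g)_{g\in G}$ are $r\times r$ matrices with non-negative entries such that $P=\sum_{g\in G}\tilde p_g$ is a stochastic matrix. Its support is $\{g\in G:\tilde p_g\neq 0\}$. It is nearest-neighbor if its support is included in $S$, and quasi-irreducible if its support generates $G$ and the matrix $P$ is irreducible. It is reversible if there is an invariant probability measure $\pi$ of $P$ such that $\pi(u)\,\tilde{\mathcal P}((g,u),(h,v))=\pi(v)\,\tilde{\mathcal P}((h,v),(g,u))$ for all $g,h\in G$ and $u,v\in[r]$. The random walk $\mathcal P$ is reversible if $\mathcal P(g,h)=\mathcal P(h,g)$ for all $g,h\in G$. A colored random walk linearizes $\mathcal P$ if for every realization $(Y_n)_{n\ge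 0}$ of it with $Y_0=(e,1)$ there are almost surely finite stopping times $0=\tau_0<\tau_1<\tau_2<\cdots$ (for the natural filtration of $Y$) such that (i) almost surely $Y_{\tau_n}$ has color $1$ for all $n$, and the $G$-coordinate of $(Y_{\tau_n})_{n\ge0}$ is a realization of the random walk with kernel $\mathcal P$ started at $e$; (ii) the increments $\tau_{n+1}-\tau_n$, $n\ge 0$, are independent and identically distributed with finite mean. Then there exist $r\ge1$ and a nearest-neighbor, quasi-irreducible colored random walk on $G\times[r]$ which linearizes $\mathcal P$. Moreover, if $\mathcal P$ is reversible, then there exist $r\ge 1$ and a nearest-neighbor, quasi-irreducible colored random walk on $G\times[r]$ which linearizes $\mathcal P$ and is reversible. -/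

import Mathlib

open MeasureTheory ProbabilityTheory

universe u

/-! ### Markov chains on a countable state space -/

/-- Under `μ`, the process `Y` is a Markov chain with transition probabilities `Q`, started at `x₀`.
The field `step` says that `ℙ[Y (n+1) = y | Y 0, …, Y n] = Q (Y n) y`, multiplied out over the
finite-dimensional events. -/
structure IsMarkovChain {Ω E : Type*} [MeasurableSpace Ω] [MeasurableSpace E]
    (Q : E → E → ℝ) (x₀ : E) (Y : ℕ → Ω → E) (μ : Measure Ω) : Prop where
  isProbabilityMeasure : IsProbabilityMeasure μ
  measurable : ∀ n, Measurable (Y n)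
  init : ∀ᵐ ω ∂μ, Y 0 ω = x₀
  step : ∀ (n : ℕ) (x : ℕ → E),
    μ.real {ω | ∀ i ≤ n + 1, Y i ω = x i} =
      μ.real {ω | ∀ i ≤ n, Y i ω = x i} * Q (x n) (x (n + 1))

/-- The kernel `Q` is reversible with respect to the measure `ν`. -/
def IsReversibleWrt {E : Type*} (Q : E → E → ℝ) (ν : E → ℝ) : Prop :=
  ∀ x y, ν x * Q x y = ν y * Q y x

/-- The natural filtration of a process. -/
def processFiltration {Ω E : Type*} [mΩ : MeasurableSpace Ω] [mE : MeasurableSpace E]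
    (Y : ℕ → Ω → E) (hY : ∀ n, Measurable (Y n)) : Filtration ℕ mΩ where
  seq n := ⨆ i ≤ n, MeasurableSpace.comap (Y i) mE
  mono' _ _ h := biSup_mono fun _ hi => le_trans hi h
  le' _ := iSup₂_le fun i _ => (hY i).comap_le

/-! ### Random times -/

/-- The `n`-th increment `τ (n+1) - τ n` of a sequence of (almost surely finite) times. -/
noncomputable def timeIncrement {Ω : Type*} (τ : ℕ → Ω → WithTop ℕ) (n : ℕ) (ω : Ω) : ℝ :=
  (((τ (n + 1) ω).untopD 0 : ℕ) : ℝ) - (((τ n ω).untopD 0 : ℕ) : ℝ)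

/-- The times `τ 0 = 0 < τ 1 < τ 2 < …` are almost surely finite and form a renewal process:
their increments are independent, identically distributed and of finite mean. -/
structure IsRenewalProcess {Ω : Type*} [MeasurableSpace Ω] (τ : ℕ → Ω → WithTop ℕ)
    (μ : Measure Ω) : Prop where
  zero : ∀ ω, τ 0 ω = 0
  finite : ∀ᵐ ω ∂μ, ∀ n, τ n ω ≠ ⊤
  strictMono : ∀ᵐ ω ∂μ, StrictMono fun n => τ n ω
  indep : iIndepFun (timeIncrement τ) μ
  identDistrib : ∀ n, IdentDistrib (timeIncrement τ n) (timeIncrement τ 0) μ μ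
  finite_mean : Integrable (timeIncrement τ 0) μ

/-- The value at the random time `σ` of the process `Y` (the value at `⊤` is irrelevant). -/
def valueAt {Ω E : Type*} (Y : ℕ → Ω → E) (σ : Ω → WithTop ℕ) (ω : Ω) : E :=
  Y ((σ ω).untopD 0) ω

/-! ### Random walks and colored random walks on a group -/

/-- The transition probabilities `p (g⁻¹ h)` of the random walk on `G` with step distribution
`p`. -/
def walkKernel {G : Type*} [Group G] (p : G → ℝ) (g h : G) : ℝ := p (g⁻¹ * h)

/-- The data of a colored random walk on `G × [r]`: matrices `p g` with non-negative entries whose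
sum over `g ∈ G` is a stochastic matrix. The set of colors `[r]` is `Fin r`; the color `1` is its
first element `0`. -/
structure ColoredWalk (G : Type*) (r : ℕ) where
  p : G → Matrix (Fin r) (Fin r) ℝ
  nonneg : ∀ g u v, 0 ≤ p g u v
  summable : Summable p
  stochastic : ∑' g, p g ∈ Matrix.rowStochastic ℝ (Fin r)

namespace ColoredWalk

variable {G : Type*} {r : ℕ}

/-- The transition matrix `P = ∑ g, p g` of the chain of colors. -/
noncomputable def colorMatrix (W : ColoredWalk G r) : Matrix (Fin r) (Fin r) ℝ := ∑' g, W.p g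

/-- The transition probabilities of the colored walk. -/
def kernel [Group G] (W : ColoredWalk G r) (x y : G × Fin r) : ℝ :=
  W.p (x.1⁻¹ * y.1) x.2 y.2

/-- The set of `g` with `p g ≠ 0`. -/
def support (W : ColoredWalk G r) : Set G := {g | W.p g ≠ 0}

/-- The support is included in the set of generators `S`. -/
def IsNearestNeighbor (W : ColoredWalk G r) (S : Set G) : Prop := W.support ⊆ S

/-- The support generates the group and the matrix of the colors is irreducible. -/
def IsQuasiIrreducible [Group G] (W : ColoredWalk G r) : Prop :=
  Subgroup.closure W.support = ⊤ ∧ W.colorMatrix.IsIrreducible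

/-- Reversibility with respect to the product of the counting measure on `G` and of an invariant
probability measure `π` of `P` on the colors. -/
def IsReversible [Group G] (W : ColoredWalk G r) : Prop :=
  ∃ π ∈ stdSimplex ℝ (Fin r), Matrix.vecMul π W.colorMatrix = π ∧
    IsReversibleWrt W.kernel fun x => π x.2

end ColoredWalk

/-- Every stochastic kernel on a countable set is the kernel of a Markov chain, so that `IsMarkovChain`
is not void. -/
theorem exists_isMarkovChain {E : Type u} [MeasurableSpace E] [Countable E]
    [DiscreteMeasurableSpace E] (Q : E → E → ℝ) (hQ : ∀ x y, 0 ≤ Q x y)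
    (hQ' : ∀ x, HasSum (Q x) 1) (x₀ : E) :
    ∃ μ : Measure (ℕ → E), IsMarkovChain Q x₀ (fun n ω => ω n) μ := by
  let q : E → PMF E := fun x => ⟨fun y => ENNReal.ofReal (Q x y), by
    have h := ENNReal.ofReal_tsum_of_nonneg (hQ x) (hQ' x).summable
    rw [(hQ' x).tsum_eq, ENNReal.ofReal_one] at h
    rw [h]; exact ENNReal.summable.hasSum⟩
  have hm : ∀ n : ℕ, Measurable fun x : (Π _ : Finset.Iic n, E) =>
      (q (x ⟨n, by simp⟩)).toMeasure := fun n =>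
    (Measurable.of_discrete (f := fun x : E => (q x).toMeasure)).comp
      (measurable_pi_apply (⟨n, by simp⟩ : Finset.Iic n))
  let κ : (n : ℕ) → Kernel (Π _ : Finset.Iic n, E) E := fun n => ⟨_, hm n⟩
  have hκ : ∀ n, IsMarkovKernel (κ n) := fun n => ⟨fun x => by
    change IsProbabilityMeasure (q (x ⟨n, by simp⟩)).toMeasure; infer_instance⟩
  refine ⟨Kernel.traj (X := fun _ => E) κ 0 (fun _ => x₀), inferInstance,
    fun n => measurable_pi_apply n, ?_, fun n x => ?_⟩
  · have h0 := Kernel.traj_map_frestrictLe_apply (X := fun _ => E) (κ := κ) 0 0 (fun _ => x₀)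
    rw [Kernel.partialTraj_self, Kernel.id_apply] at h0
    have h1 : ∀ᵐ y ∂(Measure.dirac (fun _ : Finset.Iic 0 => x₀)), y ⟨0, by simp⟩ = x₀ := by
      rw [ae_dirac_iff (measurableSet_eq_fun (measurable_pi_apply _) measurable_const)]
    rw [← h0] at h1
    exact ae_of_ae_map (by fun_prop) h1
  · set μ := Kernel.traj (X := fun _ => E) κ 0 (fun _ => x₀) with hμ
    have h := Kernel.partialTraj_compProd_eq_map_traj (X := fun _ => E) (κ := κ) (Nat.zero_le n)
      (x₀ := fun _ => x₀)
    rw [← Kernel.traj_map_frestrictLe_apply, ← hμ] at h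
    let A : Set (Π _ : Finset.Iic n, E) := {fun i : Finset.Iic n => x i}
    have hA : MeasurableSet A := measurableSet_singleton _
    have h2 := congrArg (fun m => m (A ×ˢ {x (n + 1)})) h
    beta_reduce at h2
    rw [Measure.compProd_apply_prod hA (measurableSet_singleton _),
      Measure.map_apply (by fun_prop) (hA.prod (measurableSet_singleton _))] at h2
    have e1 : (fun ω : ℕ → E => (Preorder.frestrictLe (π := fun _ => E) n ω, ω (n + 1))) ⁻¹'
        (A ×ˢ {x (n + 1)}) = {ω | ∀ i ≤ n + 1, ω i = x i} := by
      ext ω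
      simp only [A, Set.mem_preimage, Set.mem_prod, Set.mem_singleton_iff, funext_iff,
        Set.mem_ofPred_eq, Preorder.frestrictLe_apply, Subtype.forall, Finset.mem_Iic]
      constructor
      · rintro ⟨h1, h2⟩ i hi
        rcases Nat.le_succ_iff.1 hi with hi | rfl
        exacts [h1 i hi, h2]
      · exact fun h => ⟨fun i hi => h i (by omega), h _ le_rfl⟩
    have e2 : Preorder.frestrictLe (π := fun _ => E) n ⁻¹' A = {ω | ∀ i ≤ n, ω i = x i} := by
      ext ω
      simp [A, funext_iff]
    have e3 : ∫⁻ a in A, κ n a {x (n + 1)} ∂(μ.map (Preorder.frestrictLe n)) =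
        ENNReal.ofReal (Q (x n) (x (n + 1))) * μ {ω | ∀ i ≤ n, ω i = x i} := by
      have : ∀ a ∈ A, κ n a {x (n + 1)} = ENNReal.ofReal (Q (x n) (x (n + 1))) := by
        rintro a rfl
        change (q (x n)).toMeasure {x (n + 1)} = _
        rw [PMF.toMeasure_apply_singleton _ _ (measurableSet_singleton _)]
        rfl
      rw [setLIntegral_congr_fun hA this, setLIntegral_const,
        Measure.map_apply (by fun_prop) hA, e2]
    rw [e1, e3] at h2
    rw [measureReal_def, ← h2, ENNReal.toReal_mul, ENNReal.toReal_ofReal (hQ _ _), mul_comm]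
    rfl

/-- The transition probabilities of a colored walk sum to one. -/
theorem ColoredWalk.hasSum_kernel {G : Type*} [Group G] {r : ℕ} (W : ColoredWalk G r)
    (x : G × Fin r) : HasSum (W.kernel x) 1 := by
  have h1 : ∀ v, HasSum (fun g => W.p g x.2 v) ((∑' g, W.p g) x.2 v) := fun v =>
    Pi.hasSum.1 (Pi.hasSum.1 W.summable.hasSum x.2) v
  have h2 : ∑ v, (∑' g, W.p g) x.2 v = 1 := by
    simpa [Matrix.mulVec, dotProduct] using congrFun W.stochastic.2 x.2
  have h3 : ∀ v, HasSum (fun h => W.kernel x (h, v)) ((∑' g, W.p g) x.2 v) := fun v =>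
    (Equiv.mulLeft x.1⁻¹).hasSum_iff.2 (h1 v)
  have h4 : Summable (W.kernel x) := by
    rw [← (Equiv.prodComm (Fin r) G).summable_iff]
    refine (summable_prod_of_nonneg fun y => W.nonneg _ _ _).2 ⟨fun v => (h3 v).summable, ?_⟩
    exact Summable.of_finite
  have h5 := ((Equiv.prodComm (Fin r) G).hasSum_iff.2 h4.hasSum).prod_fiberwise h3
  have h6 : ∑' y, W.kernel x y = 1 := h5.unique (h2 ▸ hasSum_fintype _)
  exact h6 ▸ h4.hasSum

/-- The colored walk has a realization from every starting point. -/
theorem ColoredWalk.exists_realization {G : Type u} [Group G] [Countable G] [MeasurableSpace G]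
    [DiscreteMeasurableSpace G] {r : ℕ} (W : ColoredWalk G r) (x₀ : G × Fin r) :
    ∃ μ : Measure (ℕ → G × Fin r), IsMarkovChain W.kernel x₀ (fun n ω => ω n) μ :=
  exists_isMarkovChain _ (fun _ _ => W.nonneg _ _ _) W.hasSum_kernel x₀

/-- The colored walk `W` linearizes the random walk with step distribution `p`: every realization
`Y` of `W` started at `(e, 1)` has stopping times `τ n`, forming a renewal process, at which the
color is `1` and along which the `G`-coordinate is a realization of the random walk started
at `e`. -/
def ColoredWalk.Linearizes {G : Type u} [Group G] [MeasurableSpace G] {r : ℕ} [NeZero r]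
    (W : ColoredWalk G r) (p : G → ℝ) : Prop :=
  ∀ (Ω : Type u) [MeasurableSpace Ω] (μ : Measure Ω) (Y : ℕ → Ω → G × Fin r)
    (hY : IsMarkovChain W.kernel (1, 0) Y μ),
    ∃ τ : ℕ → Ω → WithTop ℕ,
      (∀ n, IsStoppingTime (processFiltration Y hY.measurable) (τ n)) ∧
      IsRenewalProcess τ μ ∧
      (∀ᵐ ω ∂μ, ∀ n, (valueAt Y (τ n) ω).2 = 0) ∧
      IsMarkovChain (walkKernel p) 1 (fun n ω => (valueAt Y (τ n) ω).1) μ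

/-!
Attach to the color `0` one loop of colors for each element `g` of the support of `p`, spelled by a
word for `g` of length at least `3` in the generators. At the color `0` the walk enters a loop by
one of its two ends, and inside the loops it performs a simple random walk. An excursion ends when
the walk has traversed a loop from one end to the other. By gambler's ruin, a loop of length `ℓ`
that has been entered is traversed before the next return to the color `0` with probability `1 / ℓ`;
entering the loops with probabilities biased by their lengths therefore gives the displacement
during an excursion the law `p`. The loop being visited and the index on it are read off the colors
visited since the last renewal, so the ends of the excursions are stopping times, and the strong
Markov property makes the excursions independent and identically distributed. Their duration is
integrable because the square of the index increases by `1` in mean at each step. If `p` is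
symmetric, each loop can be entered with the same probability by both ends, and then the walk is
reversible.
-/

/-! ### Countable decompositions of events -/

section Fibers

variable {Ω α : Type*} [MeasurableSpace Ω] [MeasurableSpace α] [Countable α]
  [MeasurableSingletonClass α] {μ : Measure Ω} [IsFiniteMeasure μ] {f : Ω → α} {A : Set Ω}

theorem hasSum_measureReal_inter_fiber (hf : Measurable f) (hA : MeasurableSet A) :
    HasSum (fun a => μ.real (A ∩ f ⁻¹' {a})) (μ.real A) := by
  have hfiber : ∀ a, MeasurableSet (f ⁻¹' {a}) := fun a => hf (measurableSet_singleton a)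
  have hA' : A = ⋃ a, A ∩ f ⁻¹' {a} := by ext ω; simp
  have hdisj : Pairwise (Function.onFun Disjoint fun a => A ∩ f ⁻¹' {a}) := fun a b hab =>
    Set.disjoint_left.2 fun ω ha hb => hab (ha.2.symm.trans hb.2)
  have hsum := measure_iUnion (μ := μ) hdisj fun a => hA.inter (hfiber a)
  rw [← hA'] at hsum
  simp only [measureReal_def]
  rw [hsum, ENNReal.tsum_toReal_eq fun _ => measure_ne_top _ _]
  exact ENNReal.hasSum_toReal (hsum ▸ measure_ne_top μ A)

theorem measureReal_inter_eq_mul_of_fiberwise (hf : Measurable f) (hA : MeasurableSet A)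
    {D : Set Ω} (hD : MeasurableSet D) {c : ℝ}
    (h : ∀ a, μ.real (A ∩ f ⁻¹' {a} ∩ D) = μ.real (A ∩ f ⁻¹' {a}) * c) :
    μ.real (A ∩ D) = μ.real A * c := by
  refine (hasSum_measureReal_inter_fiber hf (hA.inter hD)).unique ?_
  simp only [Set.inter_right_comm A D, h]
  exact (hasSum_measureReal_inter_fiber hf hA).mul_right c

end Fibers

/-! ### The Markov property -/

section MarkovProperty

variable {Ω E : Type*} [MeasurableSpace Ω] [MeasurableSpace E]

theorem exists_preimage_of_measurableSet_processFiltration {Y : ℕ → Ω → E}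
    (hY : ∀ n, Measurable (Y n)) {n : ℕ} {A : Set Ω}
    (hA : MeasurableSet[processFiltration Y hY n] A) :
    ∃ B : Set (Finset.Iic n → E), A = (fun ω (i : Finset.Iic n) => Y i ω) ⁻¹' B := by
  have hle : (processFiltration Y hY n : MeasurableSpace Ω) ≤
      MeasurableSpace.comap (fun ω (i : Finset.Iic n) => Y i ω) ⊤ := by
    refine iSup₂_le fun i hi => ?_
    rintro _ ⟨s, -, rfl⟩
    exact ⟨{x | x ⟨i, Finset.mem_Iic.2 hi⟩ ∈ s}, trivial, rfl⟩
  obtain ⟨B, -, h⟩ := hle A hA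
  exact ⟨B, h.symm⟩

theorem measurableSet_processFiltration_preimage {Y : ℕ → Ω → E} (hY : ∀ n, Measurable (Y n))
    {i n : ℕ} (hi : i ≤ n) {s : Set E} (hs : MeasurableSet s) :
    MeasurableSet[processFiltration Y hY n] (Y i ⁻¹' s) :=
  (le_iSup₂_of_le (f := fun j (_ : j ≤ n) => MeasurableSpace.comap (Y j) _) i hi le_rfl :
    MeasurableSpace.comap (Y i) _ ≤ processFiltration Y hY n) _ ⟨s, hs, rfl⟩

namespace IsMarkovChain

variable {Q : E → E → ℝ} {x₀ : E} {Y : ℕ → Ω → E} {μ : Measure Ω}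

theorem measureReal_cylinder_inter (hY : IsMarkovChain Q x₀ Y μ) (n : ℕ)
    (b : Finset.Iic n → E) (y : E) :
    μ.real ((fun ω (i : Finset.Iic n) => Y i ω) ⁻¹' {b} ∩ Y (n + 1) ⁻¹' {y}) =
      μ.real ((fun ω (i : Finset.Iic n) => Y i ω) ⁻¹' {b}) *
        Q (b ⟨n, Finset.mem_Iic.2 le_rfl⟩) y := by
  have hstep := hY.step n fun i => if hi : i ≤ n then b ⟨i, Finset.mem_Iic.2 hi⟩ else y
  have hpast : {ω | ∀ i ≤ n, Y i ω = if hi : i ≤ n then b ⟨i, Finset.mem_Iic.2 hi⟩ else y} =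
      (fun ω (i : Finset.Iic n) => Y i ω) ⁻¹' {b} := by
    ext ω
    simp only [Set.mem_ofPred_eq, Set.mem_preimage, Set.mem_singleton_iff, funext_iff,
      Subtype.forall, Finset.mem_Iic]
    exact forall₂_congr fun i hi => by rw [dif_pos hi]
  have hnext : {ω | ∀ i ≤ n + 1,
      Y i ω = if hi : i ≤ n then b ⟨i, Finset.mem_Iic.2 hi⟩ else y} =
      (fun ω (i : Finset.Iic n) => Y i ω) ⁻¹' {b} ∩ Y (n + 1) ⁻¹' {y} := by
    rw [← hpast]
    ext ω
    simp only [Set.mem_ofPred_eq, Set.mem_inter_iff, Set.mem_preimage, Set.mem_singleton_iff,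
      Nat.le_succ_iff, or_imp, forall_and, forall_eq, Nat.not_succ_le_self, dite_false]
  simpa [hnext, hpast] using hstep

variable [Countable E] [DiscreteMeasurableSpace E]

theorem measureReal_inter_fiber_inter_fiber (hY : IsMarkovChain Q x₀ Y μ) {n : ℕ} {A : Set Ω}
    (hA : MeasurableSet[processFiltration Y hY.measurable n] A) (x y : E) :
    μ.real (A ∩ Y n ⁻¹' {x} ∩ Y (n + 1) ⁻¹' {y}) = μ.real (A ∩ Y n ⁻¹' {x}) * Q x y := by
  have := hY.isProbabilityMeasure
  have hAx := hA.inter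
    (measurableSet_processFiltration_preimage hY.measurable le_rfl (measurableSet_singleton x))
  obtain ⟨B, hB⟩ := exists_preimage_of_measurableSet_processFiltration hY.measurable hAx
  refine measureReal_inter_eq_mul_of_fiberwise
    (measurable_pi_lambda (fun ω (i : Finset.Iic n) => Y i ω) fun i => hY.measurable i)
    ((processFiltration Y hY.measurable).le n _ hAx)
    (hY.measurable (n + 1) (measurableSet_singleton y)) fun b => ?_
  rcases Set.eq_empty_or_nonempty
    (A ∩ Y n ⁻¹' {x} ∩ (fun ω (i : Finset.Iic n) => Y i ω) ⁻¹' {b}) with hempty | ⟨ω, hω, hωb⟩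
  · simp [hempty]
  · have hb : b ∈ B := by
      rw [hB] at hω
      exact hωb ▸ hω
    have hbx : b ⟨n, Finset.mem_Iic.2 le_rfl⟩ = x := (congrFun hωb _).symm.trans hω.2
    have hcyl : A ∩ Y n ⁻¹' {x} ∩ (fun ω (i : Finset.Iic n) => Y i ω) ⁻¹' {b} =
        (fun ω (i : Finset.Iic n) => Y i ω) ⁻¹' {b} := by
      rw [hB, ← Set.preimage_inter, Set.inter_singleton_of_mem hb]
    rw [hcyl, hY.measureReal_cylinder_inter, hbx]

/-- The form of the Markov property that is used for chains lumped along a map: `c` may be the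
transition probability from one block of states to another. -/
theorem measureReal_inter_preimage_succ (hY : IsMarkovChain Q x₀ Y μ) {n : ℕ} {A : Set Ω}
    (hA : MeasurableSet[processFiltration Y hY.measurable n] A) {D : Set E} {c : ℝ}
    (hc : ∀ᵐ ω ∂μ, ω ∈ A → HasSum (D.indicator (Q (Y n ω))) c) :
    μ.real (A ∩ Y (n + 1) ⁻¹' D) = μ.real A * c := by
  have := hY.isProbabilityMeasure
  have hAm := (processFiltration Y hY.measurable).le n _ hA
  have hDm : MeasurableSet (Y (n + 1) ⁻¹' D) := hY.measurable (n + 1) .of_discrete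
  refine measureReal_inter_eq_mul_of_fiberwise (hY.measurable n) hAm hDm fun x => ?_
  have hAx : MeasurableSet (A ∩ Y n ⁻¹' {x}) := hAm.inter (hY.measurable n .of_discrete)
  by_cases hnull : μ.real (A ∩ Y n ⁻¹' {x}) = 0
  · rw [hnull, zero_mul, measureReal_mono_null Set.inter_subset_left hnull]
  obtain ⟨ω, ⟨hωA, rfl⟩, hω⟩ : ∃ ω, ω ∈ A ∩ Y n ⁻¹' {x} ∧
      (ω ∈ A → HasSum (D.indicator (Q (Y n ω))) c) :=
    ((frequently_ae_iff.2 fun h =>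
      hnull ((measureReal_eq_zero_iff (measure_ne_top _ _)).2 h)).and_eventually hc).exists
  refine (hasSum_measureReal_inter_fiber (hY.measurable (n + 1)) (hAx.inter hDm)).unique ?_
  refine ((hω hωA).mul_left _).congr_fun fun y => ?_
  by_cases hy : y ∈ D
  · rw [Set.indicator_of_mem hy, ← hY.measureReal_inter_fiber_inter_fiber hA, Set.inter_assoc _ _
      (Y (n + 1) ⁻¹' {y}), ← Set.preimage_inter, Set.inter_singleton_of_mem hy]
  · rw [Set.indicator_of_notMem hy, mul_zero, Set.inter_assoc _ _ (Y (n + 1) ⁻¹' {y}),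
      ← Set.preimage_inter, Set.inter_singleton_eq_empty.2 hy, Set.preimage_empty,
      Set.inter_empty, measureReal_empty]

theorem ae_kernel_ne_zero (hY : IsMarkovChain Q x₀ Y μ) :
    ∀ᵐ ω ∂μ, ∀ n, Q (Y n ω) (Y (n + 1) ω) ≠ 0 := by
  have := hY.isProbabilityMeasure
  refine ae_all_iff.2 fun n => ?_
  have hnull : ∀ x, ∀ᵐ ω ∂μ, ω ∉ Y n ⁻¹' {x} ∩ Y (n + 1) ⁻¹' {y | Q x y = 0} := fun x => by
    rw [← measure_eq_zero_iff_ae_notMem, ← measureReal_eq_zero_iff,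
      hY.measureReal_inter_preimage_succ (c := 0) (measurableSet_processFiltration_preimage
        hY.measurable le_rfl (measurableSet_singleton x)), mul_zero]
    filter_upwards with ω hω
    rw [show Y n ω = x from hω, Set.indicator_eq_zero'.2]
    · exact hasSum_zero
    · exact Set.disjoint_left.2 fun y hy hy' => hy hy'
  filter_upwards [ae_all_iff.2 hnull] with ω hω h
  exact hω _ ⟨rfl, h⟩

end IsMarkovChain

end MarkovProperty

theorem measurable_valueAt {Ω E : Type*} [MeasurableSpace Ω] [MeasurableSpace E] {Y : ℕ → Ω → E}
    (hY : ∀ n, Measurable (Y n)) {σ : Ω → WithTop ℕ} (hσ : Measurable fun ω => (σ ω).untopD 0) :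
    Measurable (valueAt Y σ) :=
  (measurable_from_prod_countable_right hY : Measurable fun x : ℕ × Ω => Y x.1 x.2).comp
    (hσ.prodMk measurable_id)

/-! ### Independent and identically distributed sequences -/

section IndependentSequences

variable {Ω : Type*} [MeasurableSpace Ω] {μ : Measure Ω}

section JointLaw

variable {α : Type*} [MeasurableSpace α] [Countable α] [MeasurableSingletonClass α]
  [IsProbabilityMeasure μ] {X : ℕ → Ω → α} {q : α → ℝ}

theorem map_eq_pi_of_measureReal_eq_prod (hX : ∀ n, Measurable (X n))
    (hq : ∀ (n : ℕ) (x : Fin n → α), μ.real {ω | ∀ i : Fin n, X i ω = x i} = ∏ i, q (x i)) (n : ℕ) :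
    μ.map (fun ω (i : Fin n) => X i ω) = Measure.pi fun _ => μ.map (X 0) := by
  have hXn : Measurable fun ω (i : Fin n) => X i ω := measurable_pi_lambda _ fun i => hX i
  have := Measure.isProbabilityMeasure_map (μ := μ) (hX 0).aemeasurable
  have := Measure.isProbabilityMeasure_map (μ := μ) hXn.aemeasurable
  have hsingle : ∀ a, μ.real (X 0 ⁻¹' {a}) = q a := fun a => by
    simpa [Set.preimage] using hq 1 fun _ => a
  refine Measure.ext_of_singleton fun x => ?_
  rw [Measure.pi_singleton, ← ENNReal.toReal_eq_toReal_iff' (measure_ne_top _ _)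
    (ENNReal.prod_ne_top fun i _ => measure_ne_top _ _), ENNReal.toReal_prod]
  simp only [← measureReal_def, map_measureReal_apply (hX 0) (measurableSet_singleton _), hsingle,
    map_measureReal_apply hXn (measurableSet_singleton x), ← hq n x]
  congr 1
  ext ω
  simp [funext_iff]

theorem identDistrib_of_measureReal_eq_prod (hX : ∀ n, Measurable (X n))
    (hq : ∀ (n : ℕ) (x : Fin n → α), μ.real {ω | ∀ i : Fin n, X i ω = x i} = ∏ i, q (x i)) (n : ℕ) :
    IdentDistrib (X n) (X 0) μ μ where
  aemeasurable_fst := (hX n).aemeasurable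
  aemeasurable_snd := (hX 0).aemeasurable
  map_eq := by
    have := Measure.isProbabilityMeasure_map (μ := μ) (hX 0).aemeasurable
    have h := (measurePreserving_eval (fun _ : Fin (n + 1) => μ.map (X 0)) (Fin.last n)).map_eq
    rw [← map_eq_pi_of_measureReal_eq_prod hX hq (n + 1),
      Measure.map_map (measurable_pi_apply _) (measurable_pi_lambda _ fun i => hX _)] at h
    exact h

theorem iIndepFun_of_measureReal_eq_prod (hX : ∀ n, Measurable (X n))
    (hq : ∀ (n : ℕ) (x : Fin n → α), μ.real {ω | ∀ i : Fin n, X i ω = x i} = ∏ i, q (x i)) :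
    iIndepFun X μ := by
  have hfin : ∀ n, iIndepFun (fun i : Fin n => X i) μ := fun n => by
    rw [iIndepFun_iff_map_fun_eq_pi_map (f := fun i : Fin n => X i) fun i => (hX i).aemeasurable,
      map_eq_pi_of_measureReal_eq_prod hX hq]
    simp only [(identDistrib_of_measureReal_eq_prod hX hq _).map_eq]
  refine iIndepFun_iff_finset.2 fun s => ?_
  refine (hfin (s.sup id + 1)).precomp (g := fun i : s =>
    (⟨i, Nat.lt_succ_of_le (Finset.le_sup (f := id) i.2)⟩ : Fin (s.sup id + 1))) fun i j hij => ?_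
  exact Subtype.ext (congrArg Fin.val hij)

end JointLaw

theorem lintegral_natCast_eq_tsum_measure_lt {T : Ω → ℕ} (hT : Measurable T) :
    ∫⁻ ω, (T ω : ENNReal) ∂μ = ∑' t : ℕ, μ {ω | t < T ω} := by
  have hcount : ∀ n : ℕ, (n : ENNReal) = ∑' t : ℕ, {t | t < n}.indicator (fun _ => 1) t :=
    fun n => by
      rw [tsum_eq_sum (s := Finset.range n) fun t ht =>
          Set.indicator_of_notMem (s := {t | t < n}) (mt Finset.mem_range.2 ht) _,
        Finset.sum_congr rfl fun t ht =>
          Set.indicator_of_mem (s := {t | t < n}) (Finset.mem_range.1 ht) _]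
      simp
  have hmeas : ∀ t : ℕ, MeasurableSet {ω | t < T ω} := fun t =>
    measurableSet_lt measurable_const hT
  calc ∫⁻ ω, (T ω : ENNReal) ∂μ
      = ∫⁻ ω, ∑' t : ℕ, {ω | t < T ω}.indicator (fun _ => 1) ω ∂μ :=
        lintegral_congr fun ω => hcount (T ω)
    _ = ∑' t : ℕ, μ {ω | t < T ω} := by
        rw [lintegral_tsum fun t => (measurable_const.indicator (hmeas t)).aemeasurable]
        simp only [lintegral_indicator_const (hmeas _), one_mul]

theorem integrable_natCast_of_summable_measureReal_lt [IsFiniteMeasure μ] {T : Ω → ℕ}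
    (hT : Measurable T) (h : Summable fun t : ℕ => μ.real {ω | t < T ω}) :
    Integrable (fun ω => (T ω : ℝ)) μ := by
  refine ⟨(measurable_from_top.comp hT).aestronglyMeasurable, ?_⟩
  rw [hasFiniteIntegral_iff_enorm]
  simp only [Real.enorm_natCast, lintegral_natCast_eq_tsum_measure_lt hT]
  rw [tsum_congr fun t => (ofReal_measureReal (measure_ne_top μ _)).symm,
    ← ENNReal.ofReal_tsum_of_nonneg (fun _ => measureReal_nonneg) h]
  exact ENNReal.ofReal_lt_top

section RandomWalk

variable {G : Type*} [Group G] {X : ℕ → Ω → G} {p : G → ℝ}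

theorem measureReal_path_eq_prod_of_iIndepFun [MeasurableSpace G] [DiscreteMeasurableSpace G]
    (hX0 : ∀ᵐ ω ∂μ, X 0 ω = 1) (hindep : iIndepFun (fun n ω => (X n ω)⁻¹ * X (n + 1) ω) μ)
    (hlaw : ∀ n g, μ.real {ω | (X n ω)⁻¹ * X (n + 1) ω = g} = p g) {x : ℕ → G} (hx : x 0 = 1)
    (n : ℕ) :
    μ.real {ω | ∀ i ≤ n, X i ω = x i} = ∏ i ∈ Finset.range n, p ((x i)⁻¹ * x (i + 1)) := by
  have hprod := congrArg ENNReal.toReal (hindep.measure_inter_preimage_eq_mul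
    (Finset.range n) (sets := fun i => {(x i)⁻¹ * x (i + 1)}) fun i _ => .of_discrete)
  rw [ENNReal.toReal_prod] at hprod
  refine (measureReal_congr ?_).trans (hprod.trans (Finset.prod_congr rfl fun i _ => hlaw i _))
  filter_upwards [hX0] with ω hω
  refine propext (Iff.trans ⟨fun h i hi => ?_, fun h i hi => ?_⟩ Set.mem_iInter₂.symm)
  · have hi' := Finset.mem_range.1 hi
    change (X i ω)⁻¹ * X (i + 1) ω = _
    rw [h i hi'.le, h (i + 1) hi']
  · induction i with
    | zero => rw [hω, hx]
    | succ i ih =>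
      have hinc : (X i ω)⁻¹ * X (i + 1) ω = (x i)⁻¹ * x (i + 1) := h i (Finset.mem_range.2 hi)
      rw [ih (Nat.le_of_succ_le hi)] at hinc
      exact mul_left_cancel hinc

theorem isMarkovChain_walkKernel_of_iIndepFun [MeasurableSpace G] [DiscreteMeasurableSpace G]
    (hX : ∀ n, Measurable (X n)) (hX0 : ∀ᵐ ω ∂μ, X 0 ω = 1)
    (hindep : iIndepFun (fun n ω => (X n ω)⁻¹ * X (n + 1) ω) μ)
    (hlaw : ∀ n g, μ.real {ω | (X n ω)⁻¹ * X (n + 1) ω = g} = p g) :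
    IsMarkovChain (walkKernel p) 1 X μ := by
  have := hindep.isProbabilityMeasure
  refine ⟨this, hX, hX0, fun n x => ?_⟩
  by_cases hx : x 0 = 1
  · rw [measureReal_path_eq_prod_of_iIndepFun hX0 hindep hlaw hx,
      measureReal_path_eq_prod_of_iIndepFun hX0 hindep hlaw hx, Finset.prod_range_succ, walkKernel]
  · have hnull : ∀ n, μ.real {ω | ∀ i ≤ n, X i ω = x i} = 0 := fun n => by
      rw [measureReal_eq_zero_iff, measure_eq_zero_iff_ae_notMem]
      filter_upwards [hX0] with ω hω h
      exact hx ((h 0 (Nat.zero_le n)).symm.trans hω)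
    rw [hnull, hnull, zero_mul]

end RandomWalk

end IndependentSequences

/-! ### The chain of colors -/

namespace ColoredWalk

variable {G : Type*} {r : ℕ}

theorem hasSum_p_apply (W : ColoredWalk G r) (u v : Fin r) :
    HasSum (fun g => W.p g u v) (W.colorMatrix u v) :=
  Pi.hasSum.1 (Pi.hasSum.1 W.summable.hasSum u) v

theorem colorMatrix_nonneg (W : ColoredWalk G r) (u v : Fin r) : 0 ≤ W.colorMatrix u v :=
  (W.hasSum_p_apply u v).nonneg fun g => W.nonneg g u v

theorem sum_colorMatrix (W : ColoredWalk G r) (u : Fin r) : ∑ v, W.colorMatrix u v = 1 := by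
  simpa [colorMatrix, Matrix.mulVec, dotProduct] using congrFun W.stochastic.2 u

theorem hasSum_indicator_kernel [Group G] (W : ColoredWalk G r) (x : G × Fin r) (v : Fin r) :
    HasSum ((Prod.snd ⁻¹' {v}).indicator (W.kernel x)) (W.colorMatrix x.2 v) := by
  have hinj : Function.Injective fun h : G => (h, v) := Prod.mk_left_injective v
  have hrange : (Prod.snd ⁻¹' {v} : Set (G × Fin r)) = Set.range fun h => (h, v) := by
    ext ⟨h, w⟩
    simp [eq_comm]
  rw [hrange, ← Function.Injective.hasSum_iff hinj fun y hy => Set.indicator_of_notMem hy _]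
  simp only [Function.comp_def, Set.indicator_of_mem (Set.mem_range_self _)]
  exact (Equiv.mulLeft x.1⁻¹).hasSum_iff.2 (W.hasSum_p_apply x.2 v)

theorem measureReal_inter_color_succ {Ω : Type*} [MeasurableSpace Ω] {μ : Measure Ω} [Group G]
    [MeasurableSpace G] [Countable G] [DiscreteMeasurableSpace G] {W : ColoredWalk G r}
    {x₀ : G × Fin r} {Y : ℕ → Ω → G × Fin r} (hY : IsMarkovChain W.kernel x₀ Y μ) {n : ℕ}
    {A : Set Ω} (hA : MeasurableSet[processFiltration Y hY.measurable n] A) {u : Fin r}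
    (hu : ∀ᵐ ω ∂μ, ω ∈ A → (Y n ω).2 = u) (v : Fin r) :
    μ.real (A ∩ {ω | (Y (n + 1) ω).2 = v}) = μ.real A * W.colorMatrix u v := by
  refine hY.measureReal_inter_preimage_succ (D := Prod.snd ⁻¹' {v}) hA ?_
  filter_upwards [hu] with ω hω hωA
  exact hω hωA ▸ W.hasSum_indicator_kernel (Y n ω) v

end ColoredWalk

/-! ### Renewal trackers -/

/-- An automaton that reads the colors of a colored walk. It starts at `root`, and it is sent back
to `root` after each visit to a terminal state; such a visit is called a renewal. The state of the
automaton determines the color of the walk and the displacement in `G` since the last renewal. -/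
structure RenewalTracker {G : Type*} [Group G] {r : ℕ} [NeZero r] (W : ColoredWalk G r)
    (Z : Type*) where
  root : Z
  terminal : Set Z
  next : Z → Fin r → Z
  color : Z → Fin r
  disp : Z → G
  root_notMem : root ∉ terminal
  color_root : color root = 0
  disp_root : disp root = 1
  color_terminal : ∀ z ∈ terminal, color z = 0
  color_next : ∀ z ∉ terminal, ∀ h v, W.p h (color z) v ≠ 0 → color (next z v) = v
  disp_next : ∀ z ∉ terminal, ∀ h v, W.p h (color z) v ≠ 0 → disp (next z v) = disp z * h

namespace RenewalTracker

variable {G : Type*} [Group G] {r : ℕ} [NeZero r] {W : ColoredWalk G r} {Z : Type*}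
  {R : RenewalTracker W Z}

/-! ### Expectations over an excursion -/

section Expectation

/-- The transition operator of the automaton: the expectation of a function of the next state. -/
noncomputable def transition (R : RenewalTracker W Z) : Module.End ℝ (Z → ℝ) where
  toFun φ z := ∑ v, W.colorMatrix (R.color z) v * φ (R.next z v)
  map_add' φ ψ := by
    ext z
    simp only [Pi.add_apply, mul_add, Finset.sum_add_distrib]
  map_smul' c φ := by
    ext z
    simp only [Pi.smul_apply, smul_eq_mul, Finset.mul_sum, mul_left_comm, RingHom.id_apply]

theorem transition_apply (φ : Z → ℝ) (z : Z) :
    R.transition φ z = ∑ v, W.colorMatrix (R.color z) v * φ (R.next z v) := rfl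

theorem transition_mono {φ ψ : Z → ℝ} (h : φ ≤ ψ) : R.transition φ ≤ R.transition ψ := by
  intro z
  simp only [transition_apply]
  exact Finset.sum_le_sum fun _ _ => mul_le_mul_of_nonneg_left (h _) (W.colorMatrix_nonneg _ _)

/-- The expectation of a function of the state reached after `t + 1` steps, on the event that none
of the first `t` steps leads to a terminal state. -/
noncomputable def excursionExp (R : RenewalTracker W Z) : ℕ → Module.End ℝ (Z → ℝ)
  | 0 => R.transition
  | t + 1 => R.transition * LinearMap.mulLeft ℝ (R.terminalᶜ.indicator 1) * excursionExp R t

theorem excursionExp_succ_apply (t : ℕ) (φ : Z → ℝ) :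
    R.excursionExp (t + 1) φ = R.transition (R.terminalᶜ.indicator (R.excursionExp t φ)) := by
  simp only [excursionExp, Module.End.mul_apply, LinearMap.mulLeft_apply]
  congr 1
  ext z
  by_cases hz : z ∈ R.terminal <;> simp [hz]

theorem excursionExp_mono {φ ψ : Z → ℝ} (h : φ ≤ ψ) (t : ℕ) :
    R.excursionExp t φ ≤ R.excursionExp t ψ := by
  induction t with
  | zero => exact transition_mono h
  | succ t ih =>
    rw [excursionExp_succ_apply, excursionExp_succ_apply]
    exact transition_mono fun z => Set.indicator_le_indicator (ih z)

theorem excursionExp_nonneg {φ : Z → ℝ} (h : 0 ≤ φ) (t : ℕ) (z : Z) :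
    0 ≤ R.excursionExp t φ z := by
  simpa using excursionExp_mono (R := R) h t z

theorem excursionExp_indicator_transition (t : ℕ) (φ : Z → ℝ) :
    R.excursionExp t (R.terminalᶜ.indicator (R.transition φ)) = R.excursionExp (t + 1) φ := by
  induction t with
  | zero => rw [excursionExp_succ_apply, excursionExp]
  | succ t ih => rw [excursionExp_succ_apply, ih, ← excursionExp_succ_apply]

/-- The probability that the first `t` steps avoid the terminal states and the next one leads
to `D`. -/
noncomputable def hitProb (R : RenewalTracker W Z) (D : Set Z) (t : ℕ) : Z → ℝ :=
  R.excursionExp t (D.indicator 1)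

theorem hitProb_nonneg (D : Set Z) (t : ℕ) (z : Z) : 0 ≤ R.hitProb D t z :=
  excursionExp_nonneg (fun _ => Set.indicator_nonneg (fun _ _ => zero_le_one) _) t z

/-- A nonnegative function that decreases by at least `1` in mean at each step bounds the expected
duration of an excursion. -/
theorem sum_hitProb_compl_le_transition {f : Z → ℝ} (hf : 0 ≤ f)
    (hdrift : ∀ z ∉ R.terminal, R.transition f z ≤ f z - 1) (n : ℕ) (z : Z) :
    ∑ t ∈ Finset.range n, R.hitProb R.terminalᶜ t z ≤ R.transition f z := by
  have hstep : ∀ t, R.excursionExp (t + 1) f z ≤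
      R.excursionExp t f z - R.hitProb R.terminalᶜ t z := fun t => by
    rw [← excursionExp_indicator_transition, hitProb, ← Pi.sub_apply, ← map_sub]
    refine excursionExp_mono (fun z => ?_) t z
    by_cases hz : z ∈ R.terminal
    · simpa [hz] using hf z
    · simpa [hz] using hdrift z hz
  have htelescope : R.excursionExp n f z +
      ∑ t ∈ Finset.range n, R.hitProb R.terminalᶜ t z ≤ R.transition f z := by
    induction n with
    | zero => simp [excursionExp]
    | succ n ih =>
      rw [Finset.sum_range_succ]
      linarith [hstep n]
  linarith [excursionExp_nonneg (R := R) hf n z]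

theorem summable_hitProb_compl {f : Z → ℝ} (hf : 0 ≤ f)
    (hdrift : ∀ z ∉ R.terminal, R.transition f z ≤ f z - 1) (z : Z) :
    Summable fun t => R.hitProb R.terminalᶜ t z :=
  summable_of_sum_range_le (fun t => hitProb_nonneg _ t z)
    fun n => sum_hitProb_compl_le_transition hf hdrift n z

section Harmonic

variable {H : Z → ℝ} (hH : ∀ z ∉ R.terminal, R.transition H z = H z)

include hH

theorem excursionExp_indicator_compl_of_harmonic (t : ℕ) :
    R.excursionExp t (R.terminalᶜ.indicator H) = R.excursionExp (t + 1) H := by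
  have hcompl : R.terminalᶜ.indicator H = R.terminalᶜ.indicator (R.transition H) :=
    Set.indicator_congr fun z hz => (hH z hz).symm
  rw [hcompl, excursionExp_indicator_transition]

theorem sum_excursionExp_indicator_terminal (n : ℕ) {z : Z} (hz : z ∉ R.terminal) :
    ∑ t ∈ Finset.range n, R.excursionExp t (R.terminal.indicator H) z =
      H z - R.excursionExp n H z := by
  have hstep : ∀ t, R.excursionExp t (R.terminal.indicator H) z =
      R.excursionExp t H z - R.excursionExp (t + 1) H z := fun t => by
    rw [← excursionExp_indicator_compl_of_harmonic hH, ← Pi.sub_apply, ← map_sub,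
      ← eq_sub_of_add_eq (Set.indicator_self_add_compl R.terminal H)]
  rw [Finset.sum_congr rfl fun t _ => hstep t,
    Finset.sum_range_sub' fun t => R.excursionExp t H z, excursionExp, hH z hz]

theorem abs_excursionExp_succ_le_of_harmonic {C : ℝ} (hC : ∀ z, |H z| ≤ C) (t : ℕ) (z : Z) :
    |R.excursionExp (t + 1) H z| ≤ C * R.hitProb R.terminalᶜ t z := by
  have hbound : ∀ z, |R.terminalᶜ.indicator H z| ≤ C * R.terminalᶜ.indicator 1 z := fun z => by
    by_cases hz : z ∈ R.terminal <;> simp [hz, hC z]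
  rw [← excursionExp_indicator_compl_of_harmonic hH, hitProb, ← smul_eq_mul, ← Pi.smul_apply,
    ← map_smul, abs_le, ← Pi.neg_apply, ← map_neg]
  exact ⟨excursionExp_mono (fun z => (abs_le.1 (hbound z)).1) t z,
    excursionExp_mono (fun z => (abs_le.1 (hbound z)).2) t z⟩

theorem hasSum_excursionExp_indicator_terminal {C : ℝ} (hC : ∀ z, |H z| ≤ C) {z : Z}
    (hz : z ∉ R.terminal) (hsum : Summable fun t => R.hitProb R.terminalᶜ t z)
    (hnonneg : 0 ≤ R.terminal.indicator H) :
    HasSum (fun t => R.excursionExp t (R.terminal.indicator H) z) (H z) := by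
  rw [hasSum_iff_tendsto_nat_of_nonneg fun t => excursionExp_nonneg hnonneg t z]
  simp only [sum_excursionExp_indicator_terminal hH _ hz]
  have hlim : Filter.Tendsto (fun t => R.excursionExp (t + 1) H z) Filter.atTop (nhds 0) :=
    squeeze_zero_norm (fun t => abs_excursionExp_succ_le_of_harmonic hH hC t z)
      (by simpa using hsum.tendsto_atTop_zero.const_mul C)
  rw [Filter.tendsto_add_atTop_iff_nat (f := fun t => R.excursionExp t H z) 1] at hlim
  simpa using hlim.const_sub (H z)

end Harmonic

end Expectation

/-! ### The automaton along a realization -/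

section State

open Classical in
/-- The state from which the automaton proceeds once it has reached `z`. -/
noncomputable def reset (R : RenewalTracker W Z) (z : Z) : Z := if z ∈ R.terminal then R.root else z

theorem reset_of_mem {z : Z} (h : z ∈ R.terminal) : R.reset z = R.root := if_pos h

theorem reset_of_notMem {z : Z} (h : z ∉ R.terminal) : R.reset z = z := if_neg h

theorem reset_notMem (z : Z) : R.reset z ∉ R.terminal := by
  by_cases hz : z ∈ R.terminal
  · exact (reset_of_mem hz).symm ▸ R.root_notMem
  · rwa [reset_of_notMem hz]

theorem color_reset (z : Z) : R.color (R.reset z) = R.color z := by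
  by_cases hz : z ∈ R.terminal
  · rw [reset_of_mem hz, R.color_root, R.color_terminal z hz]
  · rw [reset_of_notMem hz]

variable {Ω : Type*}

/-- The state that the automaton has reached at time `m`, before it is possibly sent back to the
root. -/
noncomputable def state (R : RenewalTracker W Z) (Y : ℕ → Ω → G × Fin r) : ℕ → Ω → Z
  | 0, _ => R.root
  | m + 1, ω => R.next (R.reset (R.state Y m ω)) (Y (m + 1) ω).2

variable [MeasurableSpace Ω] {μ : Measure Ω} [MeasurableSpace G] {Y : ℕ → Ω → G × Fin r}

theorem measurableSet_state_preimage (hY : ∀ n, Measurable (Y n)) (m : ℕ) (D : Set Z) :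
    MeasurableSet[processFiltration Y hY m] (R.state Y m ⁻¹' D) := by
  induction m generalizing D with
  | zero => exact MeasurableSet.const (R.root ∈ D)
  | succ m ih =>
    have hsplit : R.state Y (m + 1) ⁻¹' D =
        ⋃ v, R.state Y m ⁻¹' {z | R.next (R.reset z) v ∈ D} ∩ Y (m + 1) ⁻¹' (Prod.snd ⁻¹' {v}) := by
      ext ω
      simp [state]
    rw [hsplit]
    exact .iUnion fun v => ((processFiltration Y hY).mono m.le_succ _ (ih _)).inter
      (measurableSet_processFiltration_preimage hY le_rfl (measurable_snd (.singleton v)))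

variable [Countable G] [DiscreteMeasurableSpace G]

theorem ae_color_reset_state (hY : IsMarkovChain W.kernel (1, 0) Y μ) :
    ∀ᵐ ω ∂μ, ∀ m, R.color (R.reset (R.state Y m ω)) = (Y m ω).2 := by
  filter_upwards [hY.init, hY.ae_kernel_ne_zero] with ω h0 hstep m
  induction m with
  | zero => rw [color_reset, state, R.color_root, h0]
  | succ m ih =>
    rw [color_reset]
    refine R.color_next _ (reset_notMem _) ((Y m ω).1⁻¹ * (Y (m + 1) ω).1) _ ?_
    rw [ih]
    exact hstep m

theorem ae_disp_state_succ (hY : IsMarkovChain W.kernel (1, 0) Y μ) :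
    ∀ᵐ ω ∂μ, ∀ m, R.disp (R.state Y (m + 1) ω) =
      R.disp (R.reset (R.state Y m ω)) * ((Y m ω).1⁻¹ * (Y (m + 1) ω).1) := by
  filter_upwards [hY.ae_kernel_ne_zero, ae_color_reset_state hY] with ω hstep hcolor m
  refine R.disp_next _ (reset_notMem _) _ _ ?_
  rw [hcolor]
  exact hstep m

end State

/-! ### The Markov property at a renewal -/

section Excursion

variable {Ω : Type*}

/-- After time `m`, the automaton takes `t` steps that avoid the terminal states, and then a step
that leads to `D`. -/
def excursionEvent (R : RenewalTracker W Z) (Y : ℕ → Ω → G × Fin r) (D : Set Z) (m t : ℕ) :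
    Set Ω :=
  {ω | (∀ j < t, R.state Y (m + 1 + j) ω ∉ R.terminal) ∧ R.state Y (m + 1 + t) ω ∈ D}

theorem mem_excursionEvent_succ {Y : ℕ → Ω → G × Fin r} {D : Set Z} {m t : ℕ} {ω : Ω} :
    ω ∈ R.excursionEvent Y D m (t + 1) ↔
      R.state Y (m + 1) ω ∉ R.terminal ∧ ω ∈ R.excursionEvent Y D (m + 1) t := by
  simp only [excursionEvent, Set.mem_ofPred_eq, Nat.forall_lt_succ_left, and_assoc,
    add_assoc, add_comm 1]

variable [MeasurableSpace Ω] {μ : Measure Ω} [MeasurableSpace G] {Y : ℕ → Ω → G × Fin r}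

theorem measurableSet_excursionEvent (hY : ∀ n, Measurable (Y n)) (D : Set Z) (m t : ℕ) :
    MeasurableSet[processFiltration Y hY (m + 1 + t)] (R.excursionEvent Y D m t) := by
  have hstate : ∀ j ≤ t, ∀ D, MeasurableSet[processFiltration Y hY (m + 1 + t)]
      (R.state Y (m + 1 + j) ⁻¹' D) := fun j hj D =>
    (processFiltration Y hY).mono (by lia) _ (measurableSet_state_preimage hY _ D)
  have hinter : R.excursionEvent Y D m t =
      (⋂ j < t, R.state Y (m + 1 + j) ⁻¹' R.terminalᶜ) ∩ R.state Y (m + 1 + t) ⁻¹' D := by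
    ext ω
    simp [excursionEvent]
  rw [hinter]
  exact (MeasurableSet.biInter (Set.to_countable (Set.Iio t)) fun j hj =>
    hstate j (Set.mem_Iio.1 hj).le _).inter (hstate t le_rfl D)

variable [Countable G] [DiscreteMeasurableSpace G]

theorem measureReal_inter_eq_mul_transition (hY : IsMarkovChain W.kernel (1, 0) Y μ) {m : ℕ}
    {A B : Set Ω} (hA : MeasurableSet[processFiltration Y hY.measurable m] A)
    (hB : MeasurableSet B) {z : Z} (hz : ∀ ω ∈ A, R.reset (R.state Y m ω) = z) {φ : Z → ℝ}
    (hφ : ∀ v, μ.real (A ∩ {ω | (Y (m + 1) ω).2 = v} ∩ B) =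
      μ.real (A ∩ {ω | (Y (m + 1) ω).2 = v}) * φ (R.next z v)) :
    μ.real (A ∩ B) = μ.real A * R.transition φ z := by
  have := hY.isProbabilityMeasure
  have hcolor : ∀ᵐ ω ∂μ, ω ∈ A → (Y m ω).2 = R.color z := by
    filter_upwards [ae_color_reset_state (R := R) hY] with ω hω hωA
    rw [← hω, hz ω hωA]
  refine (hasSum_measureReal_inter_fiber (f := fun ω => (Y (m + 1) ω).2)
    (measurable_snd.comp (hY.measurable _))
    (((processFiltration Y hY.measurable).le m _ hA).inter hB)).unique ?_
  rw [transition_apply, Finset.mul_sum]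
  refine (hasSum_fintype _).congr_fun fun v => ?_
  rw [Set.inter_right_comm, ← mul_assoc, ← W.measureReal_inter_color_succ hY hA hcolor]
  exact hφ v

theorem measureReal_inter_state_succ (hY : IsMarkovChain W.kernel (1, 0) Y μ) {m : ℕ}
    {A : Set Ω} (hA : MeasurableSet[processFiltration Y hY.measurable m] A) {z : Z}
    (hz : ∀ ω ∈ A, R.reset (R.state Y m ω) = z) (D : Set Z) :
    μ.real (A ∩ R.state Y (m + 1) ⁻¹' D) = μ.real A * R.transition (D.indicator 1) z := by
  refine measureReal_inter_eq_mul_transition hY hA ((processFiltration Y hY.measurable).le _ _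
    (measurableSet_state_preimage hY.measurable (m + 1) D)) hz fun v => ?_
  have hnext : ∀ ω ∈ A ∩ {ω | (Y (m + 1) ω).2 = v}, R.state Y (m + 1) ω = R.next z v :=
    fun ω hω => by rw [state, hz ω hω.1, hω.2]
  by_cases hD : R.next z v ∈ D
  · rw [Set.indicator_of_mem hD, Pi.one_apply, mul_one, Set.inter_eq_left.2]
    exact fun ω hω => Set.mem_preimage.2 ((hnext ω hω).symm ▸ hD)
  · rw [Set.indicator_of_notMem hD, mul_zero, Set.disjoint_iff_inter_eq_empty.1,
      measureReal_empty]
    exact Set.disjoint_left.2 fun ω hω h => hD (hnext ω hω ▸ h)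

theorem measureReal_inter_excursionEvent (hY : IsMarkovChain W.kernel (1, 0) Y μ) {m : ℕ}
    {A : Set Ω} (hA : MeasurableSet[processFiltration Y hY.measurable m] A) {z : Z}
    (hz : ∀ ω ∈ A, R.reset (R.state Y m ω) = z) (D : Set Z) (t : ℕ) :
    μ.real (A ∩ R.excursionEvent Y D m t) = μ.real A * R.hitProb D t z := by
  induction t generalizing m A z with
  | zero =>
    have hzero : R.excursionEvent Y D m 0 = R.state Y (m + 1) ⁻¹' D := by
      ext ω
      simp [excursionEvent]
    rw [hzero]
    exact measureReal_inter_state_succ hY hA hz D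
  | succ t ih =>
    rw [hitProb, excursionExp_succ_apply]
    refine measureReal_inter_eq_mul_transition hY hA ((processFiltration Y hY.measurable).le _ _
      (measurableSet_excursionEvent hY.measurable D m (t + 1))) hz fun v => ?_
    have hnext : ∀ ω ∈ A ∩ {ω | (Y (m + 1) ω).2 = v}, R.state Y (m + 1) ω = R.next z v :=
      fun ω hω => by rw [state, hz ω hω.1, hω.2]
    by_cases hv : R.next z v ∈ R.terminal
    · rw [Set.indicator_of_notMem (Set.notMem_compl_iff.2 hv), mul_zero,
        Set.disjoint_iff_inter_eq_empty.1, measureReal_empty]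
      exact Set.disjoint_left.2 fun ω hω h =>
        (mem_excursionEvent_succ.1 h).1 ((hnext ω hω).symm ▸ hv)
    · have hAv : MeasurableSet[processFiltration Y hY.measurable (m + 1)]
          (A ∩ {ω | (Y (m + 1) ω).2 = v}) :=
        ((processFiltration Y hY.measurable).mono m.le_succ _ hA).inter
          (measurableSet_processFiltration_preimage hY.measurable le_rfl
            (measurable_snd (.singleton v)))
      have hz' : ∀ ω ∈ A ∩ {ω | (Y (m + 1) ω).2 = v}, R.reset (R.state Y (m + 1) ω) = R.next z v :=
        fun ω hω => by rw [hnext ω hω, reset_of_notMem hv]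
      have hevent : A ∩ {ω | (Y (m + 1) ω).2 = v} ∩ R.excursionEvent Y D m (t + 1) =
          A ∩ {ω | (Y (m + 1) ω).2 = v} ∩ R.excursionEvent Y D (m + 1) t := by
        ext ω
        refine and_congr_right fun hω => ?_
        rw [mem_excursionEvent_succ, hnext ω hω, and_iff_right hv]
      rw [Set.indicator_of_mem hv, hevent]
      exact ih hAv hz'

end Excursion

/-! ### Renewal times -/

section Time

variable {Ω : Type*} {Y : ℕ → Ω → G × Fin r} {ω : Ω} {n m : ℕ}

/-- The time of the `n`-th renewal. It is infinite if there are fewer than `n` renewals. -/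
noncomputable def time (R : RenewalTracker W Z) (Y : ℕ → Ω → G × Fin r) : ℕ → Ω → WithTop ℕ
  | 0, _ => 0
  | n + 1, ω => (R.time Y n ω).recTopCoe ⊤ fun m => hittingAfter (R.state Y) R.terminal (m + 1) ω

theorem time_succ_of_eq (h : R.time Y n ω = .some m) :
    R.time Y (n + 1) ω = hittingAfter (R.state Y) R.terminal (m + 1) ω := by
  rw [time, h, WithTop.recTopCoe_coe]

theorem exists_time_eq_of_time_succ_eq {k : ℕ} (h : R.time Y (n + 1) ω = .some k) :
    ∃ m t, k = m + 1 + t ∧ R.time Y n ω = .some m := by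
  rcases hn : R.time Y n ω with _ | m
  · rw [time, hn] at h
    exact absurd h (WithTop.top_ne_coe)
  · have hle : WithTop.some (m + 1) ≤ .some k :=
      h ▸ time_succ_of_eq hn ▸ le_hittingAfter (u := R.state Y) ω
    obtain ⟨t, rfl⟩ := Nat.exists_eq_add_of_le (WithTop.coe_le_coe.1 hle)
    exact ⟨m, t, rfl, rfl⟩

theorem lt_time_succ_iff (h : R.time Y n ω = .some m) (t : ℕ) :
    WithTop.some (m + 1 + t) < R.time Y (n + 1) ω ↔
      ω ∈ R.excursionEvent Y R.terminalᶜ m t := by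
  rw [time_succ_of_eq h, ← not_le, hittingAfter_le_iff]
  push Not
  refine ⟨fun hmem => ⟨fun j hj => hmem _ ⟨by lia, by lia⟩, hmem _ ⟨by lia, le_rfl⟩⟩, ?_⟩
  rintro ⟨hlt, ht⟩ k ⟨hk, hkt⟩
  obtain ⟨j, rfl⟩ := Nat.exists_eq_add_of_le hk
  rcases (Nat.add_le_add_iff_left.1 hkt).lt_or_eq with hj | rfl
  exacts [hlt j hj, ht]

theorem time_succ_eq_iff (h : R.time Y n ω = .some m) (t : ℕ) :
    R.time Y (n + 1) ω = .some (m + 1 + t) ↔ ω ∈ R.excursionEvent Y R.terminal m t := by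
  rw [time_succ_of_eq h, le_antisymm_iff, hittingAfter_le_iff, ← not_lt, hittingAfter_lt_iff]
  constructor
  · rintro ⟨⟨k, ⟨hk, hkt⟩, hmem⟩, hlt⟩
    push Not at hlt
    obtain rfl : k = m + 1 + t := by
      by_contra hne
      exact hlt k ⟨hk, by lia⟩ hmem
    exact ⟨fun j hj => hlt _ ⟨by lia, by lia⟩, hmem⟩
  · rintro ⟨hlt, ht⟩
    refine ⟨⟨_, ⟨by lia, le_rfl⟩, ht⟩, ?_⟩
    rintro ⟨k, ⟨hk, hkt⟩, hmem⟩
    obtain ⟨j, rfl⟩ := Nat.exists_eq_add_of_le hk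
    exact hlt j (by lia) hmem

theorem time_lt_time_succ (h : R.time Y n ω ≠ ⊤) : R.time Y n ω < R.time Y (n + 1) ω := by
  obtain ⟨m, hm⟩ := WithTop.ne_top_iff_exists.1 h
  rw [time_succ_of_eq hm.symm, ← hm]
  exact lt_of_lt_of_le (WithTop.coe_lt_coe.2 m.lt_succ_self) (le_hittingAfter ω)

theorem reset_state_of_time_eq (h : R.time Y n ω = .some m) : R.reset (R.state Y m ω) = R.root := by
  cases n with
  | zero =>
    obtain rfl : 0 = m := WithTop.coe_injective h
    exact reset_of_notMem R.root_notMem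
  | succ n =>
    obtain ⟨m, t, rfl, hn⟩ := exists_time_eq_of_time_succ_eq h
    exact reset_of_mem ((time_succ_eq_iff hn t).1 h).2

variable [MeasurableSpace Ω] [MeasurableSpace G]

theorem isStoppingTime_time (hY : ∀ n, Measurable (Y n)) (n : ℕ) :
    IsStoppingTime (processFiltration Y hY) (R.time Y n) := by
  induction n with
  | zero => exact isStoppingTime_const _ 0
  | succ n ih =>
    refine isStoppingTime_of_measurableSet_eq fun k => ?_
    have hsplit : {ω | R.time Y (n + 1) ω = .some k} = ⋃ m, ⋃ t, ⋃ _ : k = m + 1 + t,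
        {ω | R.time Y n ω = .some m} ∩ R.excursionEvent Y R.terminal m t := by
      ext ω
      simp only [Set.mem_iUnion, Set.mem_inter_iff, Set.mem_ofPred_eq]
      constructor
      · intro h
        obtain ⟨m, t, rfl, hm⟩ := exists_time_eq_of_time_succ_eq h
        exact ⟨m, t, rfl, hm, (time_succ_eq_iff hm t).1 h⟩
      · rintro ⟨m, t, rfl, hm, h⟩
        exact (time_succ_eq_iff hm t).2 h
    rw [hsplit]
    refine .iUnion fun m => .iUnion fun t => .iUnion ?_
    rintro rfl
    exact ((processFiltration Y hY).mono (by lia) _ (ih.measurableSet_eq m)).inter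
      (measurableSet_excursionEvent hY _ m t)

theorem measurable_untopD_time (hY : ∀ n, Measurable (Y n)) (n : ℕ) :
    Measurable fun ω => (R.time Y n ω).untopD 0 :=
  (WithTop.measurable_untopD 0).comp (isStoppingTime_time hY n).measurable'

theorem ae_time_ne_top [Countable G] [DiscreteMeasurableSpace G] {μ : Measure Ω}
    (hY : IsMarkovChain W.kernel (1, 0) Y μ)
    (hlim : Filter.Tendsto (fun t => R.hitProb R.terminalᶜ t R.root) Filter.atTop (nhds 0)) :
    ∀ᵐ ω ∂μ, ∀ n, R.time Y n ω ≠ ⊤ := by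
  have := hY.isProbabilityMeasure
  have hnull : ∀ n m : ℕ, ∀ᵐ ω ∂μ,
      ¬(R.time Y n ω = .some m ∧ R.time Y (n + 1) ω = ⊤) := fun n m => by
    have hA := (isStoppingTime_time (R := R) hY.measurable n).measurableSet_eq m
    have hsub : ∀ t, {ω | R.time Y n ω = .some m ∧ R.time Y (n + 1) ω = ⊤} ⊆
        {ω | R.time Y n ω = .some m} ∩ R.excursionEvent Y R.terminalᶜ m t := fun t ω h =>
      ⟨h.1, (lt_time_succ_iff h.1 t).1 (h.2 ▸ WithTop.coe_lt_top _)⟩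
    have hbound : ∀ t, μ.real {ω | R.time Y n ω = .some m ∧ R.time Y (n + 1) ω = ⊤} ≤
        R.hitProb R.terminalᶜ t R.root := fun t => calc
      _ ≤ μ.real ({ω | R.time Y n ω = .some m} ∩ R.excursionEvent Y R.terminalᶜ m t) :=
        measureReal_mono (hsub t)
      _ = μ.real {ω | R.time Y n ω = .some m} * R.hitProb R.terminalᶜ t R.root :=
        measureReal_inter_excursionEvent hY hA (fun ω => reset_state_of_time_eq) _ t
      _ ≤ R.hitProb R.terminalᶜ t R.root :=
        mul_le_of_le_one_left (hitProb_nonneg _ _ _) measureReal_le_one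
    exact measure_eq_zero_iff_ae_notMem.1 ((measureReal_eq_zero_iff).1
      (le_antisymm (ge_of_tendsto' hlim hbound) measureReal_nonneg))
  filter_upwards [ae_all_iff.2 fun n => ae_all_iff.2 (hnull n)] with ω hω n
  induction n with
  | zero => exact WithTop.coe_ne_top
  | succ n ih =>
    obtain ⟨m, hm⟩ := WithTop.ne_top_iff_exists.1 ih
    exact fun htop => hω n m ⟨hm.symm, htop⟩

end Time

/-! ### Excursions between renewals -/

section Renewal

variable {Ω : Type*} {Y : ℕ → Ω → G × Fin r}

/-- The number of steps of the `n`-th excursion that do not lead to a renewal, and the displacement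
in `G` during that excursion. -/
noncomputable def excursion (R : RenewalTracker W Z) (Y : ℕ → Ω → G × Fin r) (n : ℕ) (ω : Ω) :
    ℕ × G :=
  ((R.time Y (n + 1) ω).untopD 0 - (R.time Y n ω).untopD 0 - 1,
    (valueAt Y (R.time Y n) ω).1⁻¹ * (valueAt Y (R.time Y (n + 1)) ω).1)

/-- The terminal states at which the displacement is `g`. -/
def terminalAt (R : RenewalTracker W Z) (g : G) : Set Z := {z ∈ R.terminal | R.disp z = g}

theorem mem_excursionEvent_terminalAt {m t : ℕ} {g : G} {ω : Ω} :
    ω ∈ R.excursionEvent Y (R.terminalAt g) m t ↔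
      ω ∈ R.excursionEvent Y R.terminal m t ∧ R.disp (R.state Y (m + 1 + t) ω) = g :=
  and_assoc.symm

theorem disp_state_of_mem_excursionEvent {D : Set Z} {m t : ℕ} {ω : Ω}
    (hdisp : ∀ m, R.disp (R.state Y (m + 1) ω) =
      R.disp (R.reset (R.state Y m ω)) * ((Y m ω).1⁻¹ * (Y (m + 1) ω).1))
    (hroot : R.reset (R.state Y m ω) = R.root) (ht : ω ∈ R.excursionEvent Y D m t) :
    R.disp (R.state Y (m + 1 + t) ω) = (Y m ω).1⁻¹ * (Y (m + 1 + t) ω).1 := by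
  induction t generalizing D with
  | zero => rw [add_zero, hdisp, hroot, R.disp_root, one_mul]
  | succ t ih =>
    have ht' : ω ∈ R.excursionEvent Y R.terminalᶜ m t :=
      ⟨fun j hj => ht.1 j (hj.trans t.lt_succ_self), ht.1 t t.lt_succ_self⟩
    rw [← add_assoc, hdisp, reset_of_notMem ht'.2, ih ht', mul_assoc, mul_inv_cancel_left]

theorem time_succ_sub_one_eq_iff {n m : ℕ} {ω : Ω} (hm : R.time Y n ω = .some m)
    (hfin : R.time Y (n + 1) ω ≠ ⊤) (t : ℕ) :
    (R.time Y (n + 1) ω).untopD 0 - (R.time Y n ω).untopD 0 - 1 = t ↔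
      R.time Y (n + 1) ω = .some (m + 1 + t) := by
  obtain ⟨k, hk⟩ := WithTop.ne_top_iff_exists.1 hfin
  obtain ⟨m', s, rfl, hm'⟩ := exists_time_eq_of_time_succ_eq hk.symm
  obtain rfl : m' = m := WithTop.coe_injective (hm'.symm.trans hm)
  rw [hm, ← hk, WithTop.untopD_coe, WithTop.untopD_coe, WithTop.coe_inj]
  lia

theorem excursion_eq_iff {n m : ℕ} {ω : Ω}
    (hdisp : ∀ m, R.disp (R.state Y (m + 1) ω) =
      R.disp (R.reset (R.state Y m ω)) * ((Y m ω).1⁻¹ * (Y (m + 1) ω).1))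
    (hm : R.time Y n ω = .some m) (hfin : R.time Y (n + 1) ω ≠ ⊤) (x : ℕ × G) :
    R.excursion Y n ω = x ↔ ω ∈ R.excursionEvent Y (R.terminalAt x.2) m x.1 := by
  rw [excursion, Prod.ext_iff, time_succ_sub_one_eq_iff hm hfin, mem_excursionEvent_terminalAt,
    ← time_succ_eq_iff hm]
  refine and_congr_right fun ht => ?_
  rw [disp_state_of_mem_excursionEvent hdisp (reset_state_of_time_eq hm)
    ((time_succ_eq_iff hm _).1 ht), valueAt, valueAt, hm, ht, WithTop.untopD_coe,
    WithTop.untopD_coe]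

theorem timeIncrement_ae_eq [MeasurableSpace Ω] {μ : Measure Ω}
    (hfin : ∀ᵐ ω ∂μ, ∀ n, R.time Y n ω ≠ ⊤) (n : ℕ) :
    timeIncrement (R.time Y) n =ᵐ[μ] fun ω => ((R.excursion Y n ω).1 : ℝ) + 1 := by
  filter_upwards [hfin] with ω hω
  obtain ⟨m, hm⟩ := WithTop.ne_top_iff_exists.1 (hω n)
  have ht : R.time Y (n + 1) ω = .some (m + 1 + (R.excursion Y n ω).1) :=
    (time_succ_sub_one_eq_iff hm.symm (hω (n + 1)) _).1 rfl
  rw [timeIncrement, ht, ← hm, WithTop.untopD_coe, WithTop.untopD_coe]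
  push_cast
  ring

/-- The joint law of the duration and of the displacement of an excursion. -/
noncomputable def excursionLaw (R : RenewalTracker W Z) (x : ℕ × G) : ℝ :=
  R.hitProb (R.terminalAt x.2) x.1 R.root

variable [MeasurableSpace Ω] {μ : Measure Ω} [MeasurableSpace G] [Countable G]
  [DiscreteMeasurableSpace G]

theorem measurable_excursion (hY : ∀ n, Measurable (Y n)) (n : ℕ) :
    Measurable (R.excursion Y n) := by
  have hvalue : ∀ n, Measurable (valueAt Y (R.time Y n)) := fun n =>
    measurable_valueAt hY (measurable_untopD_time hY n)
  have hdiff : Measurable fun x : (G × Fin r) × (G × Fin r) => x.1.1⁻¹ * x.2.1 := .of_discrete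
  exact (((measurable_untopD_time hY (n + 1)).sub (measurable_untopD_time hY n)).sub
    measurable_const).prodMk (hdiff.comp ((hvalue n).prodMk (hvalue (n + 1))))

/-- On the event that the first `n` excursions are prescribed, the time of the `n`-th renewal is a
constant `m`; this reduces the strong Markov property to the Markov property at time `m`. -/
theorem exists_event_ae_eq_excursion_eq (hY : IsMarkovChain W.kernel (1, 0) Y μ)
    (hfin : ∀ᵐ ω ∂μ, ∀ n, R.time Y n ω ≠ ⊤) {n : ℕ} (x : Fin n → ℕ × G) :
    ∃ m : ℕ, ∃ A, MeasurableSet[processFiltration Y hY.measurable m] A ∧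
      (∀ ω ∈ A, R.time Y n ω = .some m) ∧
      (∀ᵐ ω ∂μ, (∀ i : Fin n, R.excursion Y i ω = x i) ↔ ω ∈ A) ∧
      μ.real A = ∏ i, R.excursionLaw (x i) := by
  have := hY.isProbabilityMeasure
  induction n with
  | zero => exact ⟨0, Set.univ, .univ, fun ω _ => rfl, by simp, by simp⟩
  | succ n ih =>
    obtain ⟨m, A, hA, htime, hae, hprob⟩ := ih fun i => x i.castSucc
    refine ⟨m + 1 + (x (Fin.last n)).1,
      A ∩ R.excursionEvent Y (R.terminalAt (x (Fin.last n)).2) m (x (Fin.last n)).1,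
      ((processFiltration Y hY.measurable).mono (by lia) _ hA).inter
        (measurableSet_excursionEvent hY.measurable _ m _), fun ω hω => ?_, ?_, ?_⟩
    · exact (time_succ_eq_iff (htime ω hω.1) _).2 (mem_excursionEvent_terminalAt.1 hω.2).1
    · filter_upwards [hae, hfin, ae_disp_state_succ (R := R) hY] with ω hω hfin hdisp
      refine Fin.forall_fin_succ'.trans ((and_congr_left' hω).trans ?_)
      exact and_congr_right fun hωA => excursion_eq_iff hdisp (htime ω hωA) (hfin _) _
    · rw [measureReal_inter_excursionEvent hY hA fun ω hω => reset_state_of_time_eq (htime ω hω),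
        hprob, Fin.prod_univ_castSucc, excursionLaw]

theorem measureReal_excursion_eq_prod (hY : IsMarkovChain W.kernel (1, 0) Y μ)
    (hfin : ∀ᵐ ω ∂μ, ∀ n, R.time Y n ω ≠ ⊤) (n : ℕ) (x : Fin n → ℕ × G) :
    μ.real {ω | ∀ i : Fin n, R.excursion Y i ω = x i} = ∏ i, R.excursionLaw (x i) := by
  obtain ⟨m, A, -, -, hae, hprob⟩ := exists_event_ae_eq_excursion_eq hY hfin x
  exact (measureReal_congr (Filter.eventuallyEq_set.2 hae)).trans hprob

theorem measureReal_lt_excursion_zero (hY : IsMarkovChain W.kernel (1, 0) Y μ)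
    (hfin : ∀ᵐ ω ∂μ, ∀ n, R.time Y n ω ≠ ⊤) (t : ℕ) :
    μ.real {ω | t < (R.excursion Y 0 ω).1} = R.hitProb R.terminalᶜ t R.root := by
  have := hY.isProbabilityMeasure
  have hzero : ∀ ω, R.time Y 0 ω = .some 0 := fun _ => rfl
  have hevent := measureReal_inter_excursionEvent (R := R) hY .univ
    (fun ω _ => reset_state_of_time_eq (hzero ω)) R.terminalᶜ t
  rw [Set.univ_inter, probReal_univ, one_mul] at hevent
  rw [← hevent]
  refine measureReal_congr (Filter.eventuallyEq_set.2 ?_)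
  filter_upwards [hfin] with ω hω
  have ht := (time_succ_sub_one_eq_iff (hzero ω) (hω 1) _).1 rfl
  rw [← lt_time_succ_iff (hzero ω) t, ht, WithTop.coe_lt_coe]
  exact (Nat.add_lt_add_iff_left).symm

theorem measureReal_displacement_eq (hY : IsMarkovChain W.kernel (1, 0) Y μ)
    (hfin : ∀ᵐ ω ∂μ, ∀ n, R.time Y n ω ≠ ⊤) {p : G → ℝ}
    (hp : ∀ g, HasSum (fun t => R.hitProb (R.terminalAt g) t R.root) (p g)) (n : ℕ) (g : G) :
    μ.real {ω | (R.excursion Y n ω).2 = g} = p g := by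
  have := hY.isProbabilityMeasure
  have hmeas := measurable_excursion (R := R) hY.measurable
  have hprod := measureReal_excursion_eq_prod (R := R) hY hfin
  have hzero : μ.real {ω | (R.excursion Y 0 ω).2 = g} = p g := by
    refine (hasSum_measureReal_inter_fiber (f := fun ω => (R.excursion Y 0 ω).1)
      (measurable_fst.comp (hmeas 0)) (measurable_snd.comp (hmeas 0) (.singleton g))).unique ?_
    refine (hp g).congr_fun fun t => ?_
    have hone := hprod 1 fun _ => (t, g)
    rw [Fin.prod_univ_one, excursionLaw] at hone
    rw [← hone]
    congr 1
    ext ω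
    simp [Prod.ext_iff, and_comm]
  rw [← hzero]
  have hident := (identDistrib_of_measureReal_eq_prod hmeas hprod n).comp measurable_snd
  exact congrArg ENNReal.toReal (hident.measure_mem_eq (.singleton g))

theorem isRenewalProcess_time (hY : IsMarkovChain W.kernel (1, 0) Y μ)
    (hfin : ∀ᵐ ω ∂μ, ∀ n, R.time Y n ω ≠ ⊤)
    (hsum : Summable fun t => R.hitProb R.terminalᶜ t R.root) :
    IsRenewalProcess (R.time Y) μ := by
  have := hY.isProbabilityMeasure
  have hmeas := measurable_excursion (R := R) hY.measurable
  have hprod := measureReal_excursion_eq_prod (R := R) hY hfin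
  have hinc := timeIncrement_ae_eq hfin
  have hcast : Measurable fun x : ℕ × G => (x.1 : ℝ) + 1 := .of_discrete
  have hintegrable : Integrable (fun ω => ((R.excursion Y 0 ω).1 : ℝ)) μ :=
    integrable_natCast_of_summable_measureReal_lt (measurable_fst.comp (hmeas 0)) <| by
      simpa only [measureReal_lt_excursion_zero hY hfin] using hsum
  exact {
    zero := fun _ => rfl
    finite := hfin
    strictMono := hfin.mono fun ω hω => strictMono_nat_of_lt_succ fun n => time_lt_time_succ (hω n)
    indep := ((iIndepFun_of_measureReal_eq_prod hmeas hprod).comp _ fun _ => hcast).congr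
      fun n => (hinc n).symm
    identDistrib := fun n =>
      (IdentDistrib.of_ae_eq (hcast.comp (hmeas n)).aemeasurable (hinc n).symm).symm.trans
        (((identDistrib_of_measureReal_eq_prod hmeas hprod n).comp hcast).trans
          (IdentDistrib.of_ae_eq (hcast.comp (hmeas 0)).aemeasurable (hinc 0).symm))
    finite_mean := (hintegrable.add (integrable_const 1)).congr (hinc 0).symm }

theorem ae_color_valueAt_time (hY : IsMarkovChain W.kernel (1, 0) Y μ)
    (hfin : ∀ᵐ ω ∂μ, ∀ n, R.time Y n ω ≠ ⊤) :
    ∀ᵐ ω ∂μ, ∀ n, (valueAt Y (R.time Y n) ω).2 = 0 := by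
  filter_upwards [hfin, ae_color_reset_state (R := R) hY] with ω hω hcolor n
  obtain ⟨m, hm⟩ := WithTop.ne_top_iff_exists.1 (hω n)
  rw [valueAt, ← hm, WithTop.untopD_coe, ← hcolor, reset_state_of_time_eq hm.symm, R.color_root]

theorem isMarkovChain_valueAt_time (hY : IsMarkovChain W.kernel (1, 0) Y μ)
    (hfin : ∀ᵐ ω ∂μ, ∀ n, R.time Y n ω ≠ ⊤) {p : G → ℝ}
    (hp : ∀ g, HasSum (fun t => R.hitProb (R.terminalAt g) t R.root) (p g)) :
    IsMarkovChain (walkKernel p) 1 (fun n ω => (valueAt Y (R.time Y n) ω).1) μ := by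
  have := hY.isProbabilityMeasure
  have hindep := iIndepFun_of_measureReal_eq_prod (measurable_excursion (R := R) hY.measurable)
    (measureReal_excursion_eq_prod hY hfin)
  exact isMarkovChain_walkKernel_of_iIndepFun
    (fun n => measurable_fst.comp
      (measurable_valueAt hY.measurable (measurable_untopD_time hY.measurable n)))
    (hY.init.mono fun ω hω => congrArg Prod.fst hω)
    (hindep.comp _ fun _ => measurable_snd)
    (measureReal_displacement_eq hY hfin hp)

end Renewal

/-- A Lyapunov function `f` makes the renewal times integrable; the bounded harmonic functions `H g`
identify the law of the displacement up to a renewal by optional stopping. -/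
theorem linearizes {G : Type u} [Group G] [Countable G] [MeasurableSpace G]
    [DiscreteMeasurableSpace G] {W : ColoredWalk G r} (R : RenewalTracker W Z) {p : G → ℝ}
    {f : Z → ℝ} (hf : 0 ≤ f) (hdrift : ∀ z ∉ R.terminal, R.transition f z ≤ f z - 1)
    {H : G → Z → ℝ} {C : G → ℝ} (hC : ∀ g z, |H g z| ≤ C g)
    (hharmonic : ∀ g, ∀ z ∉ R.terminal, R.transition (H g) z = H g z)
    (hroot : ∀ g, H g R.root = p g)
    (hterminal : ∀ g, R.terminal.indicator (H g) = (R.terminalAt g).indicator 1) :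
    W.Linearizes p := by
  intro Ω _ μ Y hY
  have hsum := summable_hitProb_compl hf hdrift R.root
  have hfin := ae_time_ne_top hY hsum.tendsto_atTop_zero
  refine ⟨R.time Y, isStoppingTime_time hY.measurable, isRenewalProcess_time hY hfin hsum,
    ae_color_valueAt_time hY hfin, isMarkovChain_valueAt_time hY hfin fun g => ?_⟩
  have hlaw := hasSum_excursionExp_indicator_terminal (hharmonic g) (hC g) R.root_notMem hsum
    (hterminal g ▸ fun _ => Set.indicator_nonneg (fun _ _ => zero_le_one) _)
  rwa [hroot, hterminal] at hlaw

end RenewalTracker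

/-! ### Colored walks on gain graphs -/

/-- If the mass `m` of the colors satisfies the detailed balance equations, then its normalization
is a reversible probability measure. -/
theorem ColoredWalk.isReversible_of_balance {G : Type*} [Group G] {r : ℕ} {W : ColoredWalk G r}
    {m : Fin r → ℝ} (hm : 0 ≤ m) (hpos : 0 < ∑ u, m u)
    (hbal : ∀ g u v, m u * W.p g u v = m v * W.p g⁻¹ v u) : W.IsReversible := by
  have hcolor : ∀ u v, m u * W.colorMatrix u v = m v * W.colorMatrix v u := fun u v =>
    ((W.hasSum_p_apply u v).mul_left (m u)).unique <|
      (((Equiv.inv G).hasSum_iff.2 (W.hasSum_p_apply v u)).mul_left (m v)).congr_fun fun g =>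
        hbal g u v
  refine ⟨(∑ u, m u)⁻¹ • m, ⟨fun u => mul_nonneg (inv_nonneg.2 hpos.le) (hm u), ?_⟩, ?_, ?_⟩
  · simp only [Pi.smul_apply, smul_eq_mul]
    rw [← Finset.mul_sum, inv_mul_cancel₀ hpos.ne']
  · rw [Matrix.smul_vecMul]
    congr 1
    ext v
    simp only [Matrix.vecMul, dotProduct, hcolor _ v]
    rw [← Finset.mul_sum, W.sum_colorMatrix, mul_one]
  · intro x y
    have h := hbal (x.1⁻¹ * y.1) x.2 y.2
    rw [mul_inv_rev, inv_inv] at h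
    simp only [Pi.smul_apply, smul_eq_mul, mul_assoc, ColoredWalk.kernel, h]

/-- A finite directed graph on the colors whose edges carry an element of `G`, the gain, and a
weight; the weights of the edges leaving a color are transition probabilities. -/
structure GainGraph (G : Type*) (r : ℕ) (E : Type*) [Fintype E] where
  src : E → Fin r
  tgt : E → Fin r
  gain : E → G
  weight : E → ℝ
  weight_nonneg : ∀ e, 0 ≤ weight e
  sum_weight : ∀ u, ∑ e with src e = u, weight e = 1

namespace GainGraph

variable {G : Type*} {r : ℕ} {E : Type*} [Fintype E] {Γ : GainGraph G r E}

theorem sum_single_nonneg (Γ : GainGraph G r E) (s : Finset E) (u v : Fin r) :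
    0 ≤ (∑ e ∈ s, Matrix.single (Γ.src e) (Γ.tgt e) (Γ.weight e)) u v := by
  rw [Matrix.sum_apply]
  refine Finset.sum_nonneg fun e _ => ?_
  rw [Matrix.single_apply]
  split_ifs
  exacts [Γ.weight_nonneg e, le_rfl]

theorem sum_single_mul (Γ : GainGraph G r E) (u : Fin r) (φ : Fin r → ℝ) :
    ∑ v, (∑ e, Matrix.single (Γ.src e) (Γ.tgt e) (Γ.weight e)) u v * φ v =
      ∑ e with Γ.src e = u, Γ.weight e * φ (Γ.tgt e) := by
  simp only [Matrix.sum_apply, Finset.sum_mul]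
  rw [Finset.sum_comm, Finset.sum_filter]
  refine Finset.sum_congr rfl fun e _ => ?_
  by_cases h : Γ.src e = u <;> simp [h, Matrix.single_apply]

open Classical in
theorem hasSum_sum_single (Γ : GainGraph G r E) :
    HasSum (fun h => ∑ e with Γ.gain e = h, Matrix.single (Γ.src e) (Γ.tgt e) (Γ.weight e))
      (∑ e, Matrix.single (Γ.src e) (Γ.tgt e) (Γ.weight e)) := by
  simp only [Finset.sum_filter, eq_comm (b := (_ : G))]
  exact hasSum_sum fun e _ => hasSum_ite_eq (Γ.gain e) _

open Classical in
/-- The colored walk that follows the edges of a gain graph: a step along `e` leads from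
`(g, src e)` to `(g * gain e, tgt e)`. -/
noncomputable def walk (Γ : GainGraph G r E) : ColoredWalk G r where
  p h := ∑ e with Γ.gain e = h, Matrix.single (Γ.src e) (Γ.tgt e) (Γ.weight e)
  nonneg h := Γ.sum_single_nonneg _
  summable := Γ.hasSum_sum_single.summable
  stochastic := by
    rw [Γ.hasSum_sum_single.tsum_eq]
    refine ⟨Γ.sum_single_nonneg _, funext fun u => ?_⟩
    simpa only [Matrix.mulVec, dotProduct, Pi.one_apply, mul_one, Γ.sum_weight] using
      Γ.sum_single_mul u 1

theorem sum_colorMatrix_walk_mul (u : Fin r) (φ : Fin r → ℝ) :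
    ∑ v, Γ.walk.colorMatrix u v * φ v = ∑ e with Γ.src e = u, Γ.weight e * φ (Γ.tgt e) := by
  rw [show Γ.walk.colorMatrix = _ from Γ.hasSum_sum_single.tsum_eq, Γ.sum_single_mul]

open Classical in
theorem walk_p_apply (h : G) (u v : Fin r) :
    Γ.walk.p h u v =
      ∑ e, if Γ.gain e = h ∧ Γ.src e = u ∧ Γ.tgt e = v then Γ.weight e else 0 := by
  rw [show Γ.walk.p h = ∑ e with Γ.gain e = h, _ from rfl, Matrix.sum_apply, Finset.sum_filter]
  simp only [Matrix.single_apply, ite_and]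

theorem exists_edge_of_walk_p_ne_zero {h : G} {u v : Fin r} (hne : Γ.walk.p h u v ≠ 0) :
    ∃ e, Γ.gain e = h ∧ Γ.src e = u ∧ Γ.tgt e = v := by
  classical
  rw [walk_p_apply] at hne
  obtain ⟨e, -, he⟩ := Finset.exists_ne_zero_of_sum_ne_zero hne
  exact ⟨e, (ite_ne_right_iff.1 he).1⟩

theorem walk_p_pos {e : E} (he : 0 < Γ.weight e) :
    0 < Γ.walk.p (Γ.gain e) (Γ.src e) (Γ.tgt e) := by
  classical
  rw [walk_p_apply]
  refine Finset.sum_pos' (fun e' _ => ?_) ⟨e, Finset.mem_univ e, ?_⟩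
  · split_ifs
    exacts [Γ.weight_nonneg e', le_rfl]
  · rwa [if_pos ⟨rfl, rfl, rfl⟩]

theorem support_walk_subset_range_gain : Γ.walk.support ⊆ Set.range Γ.gain := by
  intro h hh
  by_contra hrange
  refine hh (Matrix.ext fun u v => by_contra fun hne => hrange ?_)
  obtain ⟨e, he, -⟩ := exists_edge_of_walk_p_ne_zero hne
  exact ⟨e, he⟩

theorem gain_mem_support_walk {e : E} (he : 0 < Γ.weight e) : Γ.gain e ∈ Γ.walk.support :=
  fun h => (walk_p_pos he).ne' (h ▸ rfl)

theorem colorMatrix_walk_pos {e : E} (he : 0 < Γ.weight e) :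
    0 < Γ.walk.colorMatrix (Γ.src e) (Γ.tgt e) :=
  (walk_p_pos he).trans_le
    (le_hasSum (Γ.walk.hasSum_p_apply _ _) _ fun g _ => Γ.walk.nonneg g _ _)

theorem isReversible_walk [Group G] {rev : E → E} (hrev : rev.Involutive)
    (hsrc : ∀ e, Γ.src (rev e) = Γ.tgt e) (hgain : ∀ e, Γ.gain (rev e) = (Γ.gain e)⁻¹)
    {m : Fin r → ℝ} (hm : 0 ≤ m) (hpos : 0 < ∑ u, m u)
    (hbal : ∀ e, m (Γ.src e) * Γ.weight e = m (Γ.src (rev e)) * Γ.weight (rev e)) :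
    Γ.walk.IsReversible := by
  classical
  have htgt : ∀ e, Γ.tgt (rev e) = Γ.src e := fun e => by rw [← hsrc, hrev]
  refine ColoredWalk.isReversible_of_balance hm hpos fun g u v => ?_
  rw [walk_p_apply, walk_p_apply, ← Equiv.sum_comp hrev.toPerm (fun e => ite _ _ _),
    Finset.mul_sum, Finset.mul_sum]
  refine Finset.sum_congr rfl fun e _ => ?_
  simp only [hrev.coe_toPerm, hgain, htgt, hsrc, inv_eq_iff_eq_inv, and_comm (a := Γ.tgt e = u)]
  split_ifs with h
  · rw [← h.2.1, ← h.2.2, hbal, hsrc]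
  · rw [mul_zero, mul_zero]

end GainGraph

theorem isIrreducible_of_transGen {n : Type*} {A : Matrix n n ℝ} (hA : ∀ i j, 0 ≤ A i j)
    (h : ∀ i j, Relation.TransGen (fun a b => 0 < A a b) i j) : A.IsIrreducible := by
  refine ⟨hA, fun i j => ?_⟩
  let : Quiver n := A.toQuiver
  induction h i j with
  | single h => exact ⟨Quiver.Path.nil.cons ⟨h⟩, Nat.succ_pos _⟩
  | tail _ h ih =>
    obtain ⟨q, -⟩ := ih
    exact ⟨q.cons ⟨h⟩, Nat.succ_pos _⟩

/-! ### Loops of colors -/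

/-- A family of paths in `G`, of lengths `len i`. The colors are designed so that each path becomes
a loop of colors, and that these loops only meet at the color `0`. -/
structure LoopSystem (G ι : Type*) where
  len : ι → ℕ
  three_le_len : ∀ i, 3 ≤ len i
  pos : ι → ℕ → G

namespace LoopSystem

variable {G ι : Type*} {L : LoopSystem G ι}

theorem len_pos (L : LoopSystem G ι) (i : ι) : 0 < L.len i :=
  three_pos.trans_le (L.three_le_len i)

section Colors

variable [Fintype ι]

/-- The number of colors: the common base point `0` and the interior points of the loops. -/
abbrev numColors (L : LoopSystem G ι) : ℕ := Fintype.card (Σ i, Fin (L.len i - 1)) + 1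

/-- The numbering of the colors; `none` stands for the base point, and `some ⟨i, k⟩` for the point
`k + 1` of the loop `i`. -/
noncomputable def colorEquiv (L : LoopSystem G ι) :
    Option (Σ i, Fin (L.len i - 1)) ≃ Fin L.numColors :=
  (Fintype.equivFin _).optionCongr.trans (finSuccEquiv _).symm

theorem colorEquiv_none : L.colorEquiv none = 0 := rfl

/-- The color of the `j`-th point of the loop `i`. -/
noncomputable def col (L : LoopSystem G ι) (i : ι) (j : ℕ) : Fin L.numColors :=
  L.colorEquiv <| if h : 0 < j ∧ j < L.len i then some ⟨i, j - 1, by lia⟩ else none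

theorem col_of_interior {i : ι} {j : ℕ} (h : 0 < j ∧ j < L.len i) :
    L.col i j = L.colorEquiv (some ⟨i, j - 1, by lia⟩) :=
  congrArg _ (dif_pos h)

theorem col_of_not_interior {i : ι} {j : ℕ} (h : ¬(0 < j ∧ j < L.len i)) : L.col i j = 0 :=
  congrArg _ (dif_neg h)

theorem eq_of_col_eq {i i' : ι} {j j' : ℕ} (hj : 0 < j ∧ j < L.len i)
    (h : L.col i' j' = L.col i j) : i' = i ∧ j' = j := by
  rw [col_of_interior hj] at h
  by_cases hj' : 0 < j' ∧ j' < L.len i'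
  · rw [col_of_interior hj', EmbeddingLike.apply_eq_iff_eq, Option.some_inj, Sigma.mk.injEq] at h
    obtain ⟨rfl, h⟩ := h
    have := congrArg Fin.val (eq_of_heq h)
    exact ⟨rfl, by grind⟩
  · rw [col_of_not_interior hj', ← colorEquiv_none, EmbeddingLike.apply_eq_iff_eq] at h
    cases h

theorem col_eq_zero_iff {i : ι} {j : ℕ} : L.col i j = 0 ↔ ¬(0 < j ∧ j < L.len i) := by
  refine ⟨fun h hj => ?_, col_of_not_interior⟩
  rw [← col_of_not_interior (i := i) (j := 0) (by simp)] at h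
  exact hj.1.ne (eq_of_col_eq hj h.symm).2

end Colors

/-! ### The two orientations of the loops -/

section Arms

/-- The opposite orientation. An arm is a loop together with an orientation: the arm `(i, true)` is
the loop `i`, and the arm `(i, false)` is the same loop traversed backwards. -/
def flip (b : ι × Bool) : ι × Bool := (b.1, !b.2)

theorem flip_ne (b : ι × Bool) : flip b ≠ b := fun h => b.2.not_ne_self (congrArg Prod.snd h)

/-- The index on the loop `b.1` of the `j`-th point of the arm `b`. -/
def armIdx (L : LoopSystem G ι) (b : ι × Bool) (j : ℕ) : ℕ := bif b.2 then j else L.len b.1 - j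

theorem armIdx_flip (b : ι × Bool) {j : ℕ} (hj : j ≤ L.len b.1) :
    L.armIdx (flip b) j = L.armIdx b (L.len b.1 - j) := by
  obtain ⟨i, _ | _⟩ := b
  · exact (Nat.sub_sub_self hj).symm
  · rfl

theorem armIdx_interior_iff {b : ι × Bool} {j : ℕ} (hj : j ≤ L.len b.1) :
    0 < L.armIdx b j ∧ L.armIdx b j < L.len b.1 ↔ 0 < j ∧ j < L.len b.1 := by
  obtain ⟨i, _ | _⟩ := b
  · simp only [armIdx, cond_false] at hj ⊢
    lia
  · rfl

/-- The position of the `j`-th point of the path above an arm, relative to its starting point. -/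
def armPos [Group G] (L : LoopSystem G ι) (b : ι × Bool) (j : ℕ) : G :=
  (L.pos b.1 (L.armIdx b 0))⁻¹ * L.pos b.1 (L.armIdx b j)

theorem armPos_zero [Group G] (b : ι × Bool) : L.armPos b 0 = 1 := inv_mul_cancel _

/-- The `j`-th step of the path above an arm. -/
def armStep [Group G] (L : LoopSystem G ι) (b : ι × Bool) (j : ℕ) : G :=
  (L.pos b.1 (L.armIdx b j))⁻¹ * L.pos b.1 (L.armIdx b (j + 1))

theorem armPos_mul_armStep [Group G] (b : ι × Bool) (j : ℕ) :
    L.armPos b j * L.armStep b j = L.armPos b (j + 1) := by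
  rw [armPos, armStep, armPos]
  group

/-- The displacement along the whole path above an arm. -/
def endpoint [Group G] (L : LoopSystem G ι) (b : ι × Bool) : G := L.armPos b (L.len b.1)

theorem armPos_mem [Group G] {b : ι × Bool} {H : Subgroup G}
    (hstep : ∀ j : Fin (L.len b.1), L.armStep b j ∈ H) {j : ℕ} (hj : j ≤ L.len b.1) :
    L.armPos b j ∈ H := by
  induction j with
  | zero => exact armPos_zero (L := L) b ▸ H.one_mem
  | succ j ih => exact armPos_mul_armStep (L := L) b j ▸ H.mul_mem (ih (by lia)) (hstep ⟨j, hj⟩)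

variable [Fintype ι]

/-- The color of the `j`-th point of an arm. -/
noncomputable def armCol (L : LoopSystem G ι) (b : ι × Bool) (j : ℕ) : Fin L.numColors :=
  L.col b.1 (L.armIdx b j)

theorem armCol_eq_zero_iff {b : ι × Bool} {j : ℕ} (hj : j ≤ L.len b.1) :
    L.armCol b j = 0 ↔ j = 0 ∨ j = L.len b.1 := by
  rw [armCol, col_eq_zero_iff, armIdx_interior_iff hj]
  lia

theorem armCol_zero (b : ι × Bool) : L.armCol b 0 = 0 :=
  (armCol_eq_zero_iff (Nat.zero_le _)).2 (.inl rfl)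

theorem armCol_len (b : ι × Bool) : L.armCol b (L.len b.1) = 0 :=
  (armCol_eq_zero_iff le_rfl).2 (.inr rfl)

theorem armCol_flip (b : ι × Bool) {j : ℕ} (hj : j ≤ L.len b.1) :
    L.armCol (flip b) j = L.armCol b (L.len b.1 - j) := by
  rw [armCol, armIdx_flip b hj]
  rfl

theorem eq_zero_or_exists_armCol (c : Fin L.numColors) :
    c = 0 ∨ ∃ i j, j + 1 < L.len i ∧ L.armCol (i, true) (j + 1) = c := by
  obtain ⟨_ | ⟨i, k⟩, rfl⟩ := L.colorEquiv.surjective c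
  · exact .inl colorEquiv_none
  · have hk : 0 < k.1 + 1 ∧ k.1 + 1 < L.len i := by lia
    exact .inr ⟨i, k, hk.2, col_of_interior hk⟩

theorem eq_or_eq_flip_of_armCol_eq {b b' : ι × Bool} {j j' : ℕ} (hj : 0 < j) (hj' : j < L.len b.1)
    (hj'' : j' ≤ L.len b'.1) (h : L.armCol b' j' = L.armCol b j) :
    (b' = b ∧ j' = j) ∨ (b' = flip b ∧ j' = L.len b.1 - j) := by
  obtain ⟨hi, hidx⟩ := eq_of_col_eq ((armIdx_interior_iff hj'.le).2 ⟨hj, hj'⟩) h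
  obtain ⟨i, ε⟩ := b
  obtain ⟨i', ε'⟩ := b'
  obtain rfl : i' = i := hi
  cases ε <;> cases ε' <;>
    simp only [armIdx, flip, cond_true, cond_false, Bool.not_true, Bool.not_false, Prod.mk.injEq,
      true_and, Bool.true_eq_false, Bool.false_eq_true] at hidx hj' hj'' ⊢ <;> lia

theorem armCol_one_injective : Function.Injective fun b : ι × Bool => L.armCol b 1 := by
  intro b' b h
  have hb := L.three_le_len b.1
  have hb' := L.three_le_len b'.1
  rcases eq_or_eq_flip_of_armCol_eq one_pos (by lia) (by lia) h with h | h
  · exact h.1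
  · lia

/-- This is where loops of length at least `3` are needed: the color has to tell a step forward from
a step backward. -/
theorem armCol_add_two_ne (b : ι × Bool) {j : ℕ} (hj : j + 1 < L.len b.1) :
    L.armCol b (j + 2) ≠ L.armCol b j := by
  intro h
  have hb := L.three_le_len b.1
  rcases Nat.eq_zero_or_pos j with rfl | hjpos
  · rw [armCol_zero, armCol_eq_zero_iff hj] at h
    lia
  · rcases eq_or_eq_flip_of_armCol_eq hjpos (by lia) hj h with h | h
    · lia
    · exact flip_ne b h.1.symm

end Arms

section Edges

/-- The edges of the loops, in both orientations: `⟨b, j⟩` leads from the `j`-th point of the arm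
`b` to the next one. -/
abbrev Edge (L : LoopSystem G ι) : Type _ := Σ b : ι × Bool, Fin (L.len b.1)

/-- The same edge traversed backwards. -/
def Edge.rev (e : L.Edge) : L.Edge :=
  ⟨flip e.1, L.len e.1.1 - (e.2 + 1), Nat.sub_lt (L.len_pos _) e.2.1.succ_pos⟩

theorem Edge.rev_involutive : (Edge.rev : L.Edge → L.Edge).Involutive := by
  rintro ⟨⟨i, _ | _⟩, j⟩ <;> exact congrArg (Sigma.mk _) (Fin.rev_rev j)

theorem armStep_rev [Group G] (e : L.Edge) :
    L.armStep e.rev.1 e.rev.2 = (L.armStep e.1 e.2)⁻¹ := by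
  obtain ⟨b, j, hj⟩ := e
  have hsrc : L.armIdx (flip b) (L.len b.1 - (j + 1)) = L.armIdx b (j + 1) := by
    rw [armIdx_flip b (Nat.sub_le _ _), Nat.sub_sub_self hj]
  have htgt : L.armIdx (flip b) (L.len b.1 - (j + 1) + 1) = L.armIdx b j := by
    rw [armIdx_flip b (by lia)]
    congr 1
    lia
  simp only [armStep, Edge.rev, hsrc, htgt, mul_inv_rev, inv_inv]
  rfl

variable {enter : ι × Bool → ℝ}

/-- The probability of an edge when the arms are entered with the probabilities `enter` at the base
point, and the walk is simple inside the loops. -/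
noncomputable def edgeWeight (enter : ι × Bool → ℝ) (e : L.Edge) : ℝ :=
  if e.2.1 = 0 then enter e.1 else 1 / 2

theorem edgeWeight_zero (b : ι × Bool) (h : 0 < L.len b.1) :
    edgeWeight (L := L) enter ⟨b, 0, h⟩ = enter b :=
  if_pos rfl

theorem edgeWeight_succ (b : ι × Bool) {j : ℕ} (h : j + 1 < L.len b.1) :
    edgeWeight (L := L) enter ⟨b, j + 1, h⟩ = 1 / 2 :=
  if_neg j.succ_ne_zero

theorem edgeWeight_rev (b : ι × Bool) {j : ℕ} (h : j + 1 < L.len b.1) :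
    edgeWeight (L := L) enter (Edge.rev ⟨b, j, by lia⟩) = 1 / 2 :=
  if_neg (Nat.sub_ne_zero_of_lt h)

variable [Fintype ι]

theorem armCol_rev (e : L.Edge) : L.armCol e.rev.1 e.rev.2 = L.armCol e.1 (e.2 + 1) := by
  rw [Edge.rev, armCol_flip _ (Nat.sub_le _ _), Nat.sub_sub_self e.2.2]

theorem armCol_rev_succ (e : L.Edge) : L.armCol e.rev.1 (e.rev.2 + 1) = L.armCol e.1 e.2 := by
  rw [← armCol_rev, Edge.rev_involutive]

theorem armCol_src_eq_zero_iff (e : L.Edge) : L.armCol e.1 e.2 = 0 ↔ e.2.1 = 0 := by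
  rw [armCol_eq_zero_iff e.2.2.le, or_iff_left e.2.2.ne]

theorem armCol_src_eq_armCol_succ_iff {b : ι × Bool} {j : ℕ} (hj : j + 1 < L.len b.1) (e : L.Edge) :
    L.armCol e.1 e.2 = L.armCol b (j + 1) ↔
      e = ⟨b, j + 1, hj⟩ ∨ e = Edge.rev ⟨b, j, by lia⟩ := by
  refine ⟨fun h => ?_, ?_⟩
  · obtain ⟨b', j', hj'⟩ := e
    obtain ⟨rfl, rfl⟩ | ⟨rfl, rfl⟩ := eq_or_eq_flip_of_armCol_eq j.succ_pos hj hj'.le h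
    exacts [.inl rfl, .inr rfl]
  · rintro (rfl | rfl)
    exacts [rfl, armCol_rev _]

theorem sum_edges_base (ψ : L.Edge → ℝ) :
    ∑ e with L.armCol e.1 e.2 = 0, ψ e = ∑ b, ψ ⟨b, 0, L.len_pos b.1⟩ := by
  simp only [armCol_src_eq_zero_iff, Finset.sum_filter, Fintype.sum_sigma]
  refine Finset.sum_congr rfl fun b _ => ?_
  rw [Fintype.sum_eq_single ⟨0, L.len_pos b.1⟩ fun j hj => if_neg fun h => hj (Fin.ext h),
    if_pos rfl]

theorem sum_edges_interior {b : ι × Bool} {j : ℕ} (hj : j + 1 < L.len b.1) (ψ : L.Edge → ℝ) :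
    ∑ e with L.armCol e.1 e.2 = L.armCol b (j + 1), ψ e =
      ψ ⟨b, j + 1, hj⟩ + ψ (Edge.rev ⟨b, j, by lia⟩) := by
  classical
  have hne : (⟨b, j + 1, hj⟩ : L.Edge) ≠ Edge.rev ⟨b, j, by lia⟩ := fun h =>
    flip_ne b (congrArg Sigma.fst h).symm
  rw [← Finset.sum_pair hne]
  exact Finset.sum_congr (Finset.ext fun e => by simp [armCol_src_eq_armCol_succ_iff hj])
    fun _ _ => rfl

end Edges

/-! ### The walk around the loops -/

section Walk

variable [Fintype ι] {enter : ι × Bool → ℝ}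

/-- The reversible mass of the walk around the loops, when `enter` is symmetric. -/
noncomputable def colorMass (L : LoopSystem G ι) (enter : ι × Bool → ℝ) (u : Fin L.numColors) : ℝ :=
  (L.colorEquiv.symm u).elim 1 fun x => 2 * enter (x.1, true)

theorem colorMass_src_mul_edgeWeight (hsymm : ∀ b, enter (flip b) = enter b) (e : L.Edge) :
    L.colorMass enter (L.armCol e.1 e.2) * edgeWeight enter e = enter e.1 := by
  obtain ⟨⟨i, ε⟩, j, hj⟩ := e
  have hε : enter (i, ε) = enter (i, true) := by
    cases ε
    exacts [hsymm (i, true), rfl]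
  rcases j with _ | j
  · rw [edgeWeight_zero, armCol_zero, ← colorEquiv_none, colorMass, Equiv.symm_apply_apply]
    exact one_mul _
  · have hint := (armIdx_interior_iff hj.le).2 ⟨j.succ_pos, hj⟩
    rw [edgeWeight_succ, armCol, col_of_interior hint, colorMass, Equiv.symm_apply_apply, hε]
    simp only [Option.elim_some]
    ring

variable [Group G]

/-- The gain graph made of the loops, all attached to the color `0`. -/
noncomputable def gainGraph (L : LoopSystem G ι) (henter : enter ∈ stdSimplex ℝ (ι × Bool)) :
    GainGraph G L.numColors L.Edge where
  src e := L.armCol e.1 e.2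
  tgt e := L.armCol e.1 (e.2 + 1)
  gain e := L.armStep e.1 e.2
  weight := edgeWeight enter
  weight_nonneg e := by
    rw [edgeWeight]
    split_ifs
    exacts [henter.1 _, one_half_pos.le]
  sum_weight u := by
    obtain rfl | ⟨i, j, hj, rfl⟩ := eq_zero_or_exists_armCol u
    · rw [sum_edges_base]
      simpa only [edgeWeight_zero] using henter.2
    · rw [sum_edges_interior (b := (i, true)) hj, edgeWeight_succ, edgeWeight_rev _ hj, add_halves]

/-- The colored walk around the loops: at the color `0` it chooses an arm according to `enter`, and
inside a loop it performs a simple random walk. -/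
noncomputable abbrev walk (L : LoopSystem G ι) (henter : enter ∈ stdSimplex ℝ (ι × Bool)) :
    ColoredWalk G L.numColors :=
  (L.gainGraph henter).walk

variable {henter : enter ∈ stdSimplex ℝ (ι × Bool)}

theorem sum_colorMatrix_walk_base (φ : Fin L.numColors → ℝ) :
    ∑ v, (L.walk henter).colorMatrix 0 v * φ v = ∑ b, enter b * φ (L.armCol b 1) := by
  rw [GainGraph.sum_colorMatrix_walk_mul]
  refine (sum_edges_base _).trans (Finset.sum_congr rfl fun b _ => ?_)
  exact congrArg (· * φ (L.armCol b 1)) (edgeWeight_zero b _)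

theorem sum_colorMatrix_walk_interior {b : ι × Bool} {j : ℕ} (hj : j + 1 < L.len b.1)
    (φ : Fin L.numColors → ℝ) :
    ∑ v, (L.walk henter).colorMatrix (L.armCol b (j + 1)) v * φ v =
      1 / 2 * φ (L.armCol b (j + 2)) + 1 / 2 * φ (L.armCol b j) := by
  rw [GainGraph.sum_colorMatrix_walk_mul]
  refine (sum_edges_interior hj _).trans ?_
  simp only [gainGraph, edgeWeight_succ, edgeWeight_rev b hj, armCol_rev_succ]

theorem isNearestNeighbor_walk {S : Set G} (hS : ∀ g ∈ S, g⁻¹ ∈ S)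
    (hstep : ∀ i, ∀ j < L.len i, (L.pos i j)⁻¹ * L.pos i (j + 1) ∈ S) :
    (L.walk henter).IsNearestNeighbor S := by
  refine GainGraph.support_walk_subset_range_gain.trans ?_
  rintro _ ⟨⟨⟨i, _ | _⟩, j⟩, rfl⟩
  · rw [← Edge.rev_involutive ⟨(i, false), j⟩]
    change L.armStep _ _ ∈ S
    rw [armStep_rev]
    exact hS _ (hstep i _ (Fin.rev j).2)
  · exact hstep i j j.2

theorem weight_gainGraph_pos {b : ι × Bool} (hb : 0 < enter b) (j : Fin (L.len b.1)) :
    0 < (L.gainGraph henter).weight ⟨b, j⟩ := by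
  change 0 < ite _ _ _
  split_ifs
  exacts [hb, one_half_pos]

theorem transGen_armCol {b : ι × Bool} (hb : 0 < enter b) {j k : ℕ} (hjk : j < k)
    (hk : k ≤ L.len b.1) :
    Relation.TransGen (fun u v => 0 < (L.walk henter).colorMatrix u v)
      (L.armCol b j) (L.armCol b k) := by
  have hstep : ∀ i ∈ Set.Ico j k, 0 < (L.walk henter).colorMatrix (L.armCol b i)
      (L.armCol b (i + 1)) := fun i hi =>
    GainGraph.colorMatrix_walk_pos (weight_gainGraph_pos hb ⟨i, hi.2.trans_le hk⟩)
  exact (transGen_of_succ_of_lt (fun i l => 0 < (L.walk henter).colorMatrix (L.armCol b i)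
    (L.armCol b l)) hstep hjk).lift _ fun _ _ h => h

theorem isIrreducible_colorMatrix_walk [Nonempty ι] (hpos : ∀ i, 0 < enter (i, true)) :
    (L.walk henter).colorMatrix.IsIrreducible := by
  have hbase : ∀ c, Relation.TransGen (fun u v => 0 < (L.walk henter).colorMatrix u v) 0 c ∧
      Relation.TransGen (fun u v => 0 < (L.walk henter).colorMatrix u v) c 0 := by
    intro c
    obtain rfl | ⟨i, j, hj, rfl⟩ := eq_zero_or_exists_armCol c
    · obtain ⟨i⟩ := ‹Nonempty ι›
      have h := transGen_armCol (henter := henter) (hpos i) (L.len_pos i) le_rfl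
      rw [armCol_zero, armCol_len] at h
      exact ⟨h, h⟩
    · have hto := transGen_armCol (henter := henter) (hpos i) j.succ_pos hj.le
      have hfrom := transGen_armCol (henter := henter) (hpos i) hj le_rfl
      rw [armCol_zero] at hto
      rw [armCol_len] at hfrom
      exact ⟨hto, hfrom⟩
  exact isIrreducible_of_transGen (ColoredWalk.colorMatrix_nonneg _) fun u v =>
    (hbase u).2.trans (hbase v).1

theorem isQuasiIrreducible_walk [Nonempty ι] (hpos : ∀ i, 0 < enter (i, true))
    (hgen : Subgroup.closure (Set.range fun i => L.endpoint (i, true)) = ⊤) :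
    (L.walk henter).IsQuasiIrreducible := by
  refine ⟨?_, isIrreducible_colorMatrix_walk hpos⟩
  rw [eq_top_iff, ← hgen, Subgroup.closure_le]
  rintro _ ⟨i, rfl⟩
  exact armPos_mem (fun j => Subgroup.subset_closure
    (GainGraph.gain_mem_support_walk (weight_gainGraph_pos (hpos i) j))) le_rfl

theorem isReversible_walk (hsymm : ∀ b, enter (flip b) = enter b) :
    (L.walk henter).IsReversible := by
  have hmass : 0 ≤ L.colorMass enter := fun u => by
    rw [colorMass]
    cases L.colorEquiv.symm u
    exacts [zero_le_one, mul_nonneg zero_le_two (henter.1 _)]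
  have hbase : L.colorMass enter 0 = 1 := by
    rw [← colorEquiv_none, colorMass, Equiv.symm_apply_apply]
    rfl
  refine GainGraph.isReversible_walk Edge.rev_involutive armCol_rev armStep_rev hmass
    (Finset.sum_pos' (fun u _ => hmass u) ⟨0, Finset.mem_univ _, hbase ▸ one_pos⟩) fun e => ?_
  exact (colorMass_src_mul_edgeWeight hsymm e).trans
    ((hsymm e.1).symm.trans (colorMass_src_mul_edgeWeight hsymm e.rev).symm)

end Walk

/-! ### Gambler's ruin on the arms -/

section Tracker

/-- A point of an arm: the part of the past of the walk since its last visit to a base point that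
determines its displacement and the end of the current traversal. -/
structure Site (L : LoopSystem G ι) where
  arm : ι × Bool
  idx : ℕ
  idx_le : idx ≤ L.len arm.1

namespace Site

section Position

variable [Fintype ι]

/-- The color of a site. -/
noncomputable def color (z : L.Site) : Fin L.numColors := L.armCol z.arm z.idx

/-- The site reached from `z` by a step to the color `v`. -/
noncomputable def next (z : L.Site) (v : Fin L.numColors) : L.Site :=
  open Classical in
  if hz : z.idx < L.len z.arm.1 then
    if z.idx = 0 then
      ⟨Function.extend (fun b => L.armCol b 1) id (fun _ => z.arm) v, 1, L.len_pos _⟩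
    else if v = L.armCol z.arm (z.idx + 1) then ⟨z.arm, z.idx + 1, hz⟩
    else ⟨z.arm, z.idx - 1, (Nat.sub_le _ _).trans z.idx_le⟩
  else z

theorem next_base (b b' : ι × Bool) :
    next (L := L) ⟨b, 0, Nat.zero_le _⟩ (L.armCol b' 1) = ⟨b', 1, L.len_pos _⟩ := by
  simp only [next, L.len_pos, dite_true, if_true, armCol_one_injective.extend_apply, id]

theorem next_forward {b : ι × Bool} {j : ℕ} (hj : j + 1 < L.len b.1) :
    next ⟨b, j + 1, hj.le⟩ (L.armCol b (j + 2)) = ⟨b, j + 2, hj⟩ := by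
  rw [next, dif_pos hj, if_neg j.succ_ne_zero, if_pos rfl]

theorem next_backward {b : ι × Bool} {j : ℕ} (hj : j + 1 < L.len b.1) :
    next ⟨b, j + 1, hj.le⟩ (L.armCol b j) = ⟨b, j, by lia⟩ := by
  rw [next, dif_pos hj, if_neg j.succ_ne_zero, if_neg (armCol_add_two_ne b hj).symm]
  rfl

/-- A potential that decreases by `1` in mean at each step of the walk around the loops: the square
of the index on the arm increases by `1`, as for every simple random walk. -/
noncomputable def potential (z : L.Site) : ℝ := (∑ i, L.len i : ℕ) ^ 2 - z.idx ^ 2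

theorem potential_nonneg (z : L.Site) : 0 ≤ z.potential := by
  have h : z.idx ≤ ∑ i, L.len i :=
    z.idx_le.trans (Finset.single_le_sum (fun _ _ => Nat.zero_le _) (Finset.mem_univ _))
  exact sub_nonneg.2 (by gcongr)

end Position

variable [Group G]

/-- The displacement of the walk since its last visit to a base point. -/
def disp (z : L.Site) : G := L.armPos z.arm z.idx

open Classical in
/-- The probability that the current traversal ends with the displacement `g`, when `p` is the law
of this displacement at the base point. By gambler's ruin, an arm `b` with current index `j` is
traversed before the next return to the base point with probability `j / len b`. -/
noncomputable def endProb (p : G → ℝ) (g : G) (z : L.Site) : ℝ :=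
  (1 - z.idx / L.len z.arm.1) * p g + z.idx / L.len z.arm.1 * if L.endpoint z.arm = g then 1 else 0

theorem endProb_zero (p : G → ℝ) (g : G) (b : ι × Bool) :
    endProb (L := L) p g ⟨b, 0, Nat.zero_le _⟩ = p g := by
  simp only [endProb, Nat.cast_zero, zero_div, sub_zero, one_mul, zero_mul, add_zero]

theorem endProb_of_idx_eq_len (p : G → ℝ) (g : G) {z : L.Site} (hz : z.idx = L.len z.arm.1) :
    endProb p g z = {z : L.Site | z.disp = g}.indicator 1 z := by
  have hlen : (L.len z.arm.1 : ℝ) ≠ 0 := Nat.cast_ne_zero.2 (L.len_pos _).ne'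
  rw [endProb, hz, div_self hlen, sub_self, zero_mul, zero_add, one_mul, endpoint, ← hz]
  rfl

theorem abs_endProb_le (p : G → ℝ) (g : G) (z : L.Site) : |endProb p g z| ≤ |p g| + 1 := by
  have h0 : (0 : ℝ) ≤ z.idx / L.len z.arm.1 := by positivity
  have h1 : (z.idx : ℝ) / L.len z.arm.1 ≤ 1 :=
    div_le_one_of_le₀ (Nat.cast_le.2 z.idx_le) (Nat.cast_nonneg _)
  rw [endProb]
  refine (abs_add_le _ _).trans (add_le_add ?_ ?_) <;> rw [abs_mul]
  · refine mul_le_of_le_one_left (abs_nonneg _) ?_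
    rw [abs_of_nonneg (sub_nonneg.2 h1)]
    exact sub_le_self _ h0
  · rw [abs_of_nonneg h0]
    refine mul_le_one₀ h1 (abs_nonneg _) ?_
    split_ifs <;> simp

variable [Fintype ι] {enter : ι × Bool → ℝ} {henter : enter ∈ stdSimplex ℝ (ι × Bool)}

theorem color_disp_next {z : L.Site} (hz : z.idx < L.len z.arm.1) {h : G} {v : Fin L.numColors}
    (hne : (L.walk henter).p h z.color v ≠ 0) :
    (z.next v).color = v ∧ (z.next v).disp = z.disp * h := by
  obtain ⟨e, rfl, hsrc, rfl⟩ := GainGraph.exists_edge_of_walk_p_ne_zero hne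
  change L.armCol e.1 e.2 = L.armCol z.arm z.idx at hsrc
  change (z.next (L.armCol e.1 (e.2 + 1))).color = L.armCol e.1 (e.2 + 1) ∧
    (z.next (L.armCol e.1 (e.2 + 1))).disp = z.disp * L.armStep e.1 e.2
  obtain ⟨b, _ | j, hj⟩ := z
  · obtain ⟨b', j', hj'⟩ := e
    obtain rfl : j' = 0 := (armCol_src_eq_zero_iff _).1 (hsrc.trans (armCol_zero b))
    rw [next_base, disp, disp, armPos_zero, one_mul, ← armPos_mul_armStep, armPos_zero, one_mul]
    exact ⟨rfl, rfl⟩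
  · obtain rfl | rfl := (armCol_src_eq_armCol_succ_iff hz e).1 hsrc
    · rw [next_forward hz]
      exact ⟨rfl, (armPos_mul_armStep b (j + 1)).symm⟩
    · rw [armCol_rev_succ, next_backward hz, armStep_rev]
      exact ⟨rfl, eq_mul_inv_of_mul_eq (armPos_mul_armStep b j)⟩

end Site

variable [Fintype ι] [Group G] {enter : ι × Bool → ℝ} {henter : enter ∈ stdSimplex ℝ (ι × Bool)}

/-- The renewal tracker of the walk around the loops, whose renewals are the ends of the traversals
of the arms; the arm of the root is arbitrary. -/
noncomputable def tracker (henter : enter ∈ stdSimplex ℝ (ι × Bool)) (b₀ : ι × Bool) :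
    RenewalTracker (L.walk henter) L.Site where
  root := ⟨b₀, 0, Nat.zero_le _⟩
  terminal := {z | z.idx = L.len z.arm.1}
  next := Site.next
  color := Site.color
  disp := Site.disp
  root_notMem := (L.len_pos _).ne
  color_root := armCol_zero b₀
  disp_root := armPos_zero b₀
  color_terminal z hz := (congrArg (L.armCol z.arm) hz).trans (armCol_len _)
  color_next z hz _ _ hne := (Site.color_disp_next (z.idx_le.lt_of_ne hz) hne).1
  disp_next z hz _ _ hne := (Site.color_disp_next (z.idx_le.lt_of_ne hz) hne).2

theorem transition_tracker_base {b₀ : ι × Bool} (b : ι × Bool) (φ : L.Site → ℝ) :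
    (tracker henter b₀).transition φ ⟨b, 0, Nat.zero_le _⟩ =
      ∑ b', enter b' * φ ⟨b', 1, L.len_pos _⟩ := by
  have h := sum_colorMatrix_walk_base (henter := henter)
    (fun v => φ (Site.next (L := L) ⟨b, 0, Nat.zero_le _⟩ v))
  simp only [Site.next_base] at h
  rw [← h, ← armCol_zero b]
  rfl

theorem transition_tracker_interior {b₀ b : ι × Bool} {j : ℕ} (hj : j + 1 < L.len b.1)
    (φ : L.Site → ℝ) :
    (tracker henter b₀).transition φ ⟨b, j + 1, hj.le⟩ =
      1 / 2 * φ ⟨b, j + 2, hj⟩ + 1 / 2 * φ ⟨b, j, by lia⟩ := by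
  rw [← Site.next_forward hj, ← Site.next_backward hj]
  exact sum_colorMatrix_walk_interior hj (fun v => φ (Site.next ⟨b, j + 1, hj.le⟩ v))

theorem transition_tracker_potential (b₀ : ι × Bool) {z : L.Site} (hz : z.idx < L.len z.arm.1) :
    (tracker henter b₀).transition Site.potential z = z.potential - 1 := by
  obtain ⟨b, _ | j, hj⟩ := z
  · rw [transition_tracker_base]
    simp only [Site.potential, ← Finset.sum_mul, henter.2]
    norm_num
  · rw [transition_tracker_interior hz]
    simp only [Site.potential]
    push_cast
    ring

open Classical in
theorem transition_tracker_endProb (b₀ : ι × Bool) {p : G → ℝ} {g : G}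
    (hp : ∑ b with L.endpoint b = g, enter b / L.len b.1 = (∑ b, enter b / L.len b.1) * p g)
    {z : L.Site} (hz : z.idx < L.len z.arm.1) :
    (tracker henter b₀).transition (Site.endProb p g) z = Site.endProb p g z := by
  obtain ⟨b, _ | j, hj⟩ := z
  · rw [transition_tracker_base]
    calc ∑ b, enter b * Site.endProb p g ⟨b, 1, L.len_pos _⟩
        = (∑ b, enter b) * p g - (∑ b, enter b / L.len b.1) * p g +
            ∑ b with L.endpoint b = g, enter b / L.len b.1 := by
          rw [Finset.sum_filter, Finset.sum_mul, Finset.sum_mul, ← Finset.sum_sub_distrib,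
            ← Finset.sum_add_distrib]
          refine Finset.sum_congr rfl fun b _ => ?_
          rw [Site.endProb]
          split_ifs <;> push_cast <;> ring
      _ = Site.endProb p g ⟨b, 0, hj⟩ := by
          rw [hp, henter.2, one_mul, sub_add_cancel, Site.endProb_zero]
  · rw [transition_tracker_interior hz]
    simp only [Site.endProb]
    push_cast
    ring

open Classical in
theorem linearizes_walk {G : Type u} [Group G] [Countable G] [MeasurableSpace G]
    [DiscreteMeasurableSpace G] [Nonempty ι] {L : LoopSystem G ι}
    {henter : enter ∈ stdSimplex ℝ (ι × Bool)} {p : G → ℝ}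
    (hp : ∀ g, ∑ b with L.endpoint b = g, enter b / L.len b.1 =
      (∑ b, enter b / L.len b.1) * p g) :
    (L.walk henter).Linearizes p := by
  obtain ⟨i⟩ := ‹Nonempty ι›
  refine (tracker henter (i, true)).linearizes Site.potential_nonneg
    (fun z hz => (transition_tracker_potential _ (z.idx_le.lt_of_ne hz)).le) (Site.abs_endProb_le p)
    (fun g z hz => transition_tracker_endProb _ (hp g) (z.idx_le.lt_of_ne hz))
    (fun g => Site.endProb_zero p g _) fun g => ?_
  exact (Set.indicator_congr fun z hz => Site.endProb_of_idx_eq_len p g hz).trans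
    (Set.indicator_indicator _ {z : L.Site | z.disp = g} 1)

end Tracker

/-! ### Length-biased choice of the arms -/

section LengthBiased

theorem endpoint_flip [Group G] (b : ι × Bool) : L.endpoint (flip b) = (L.endpoint b)⁻¹ := by
  have hzero : L.armIdx (flip b) 0 = L.armIdx b (L.len b.1) := armIdx_flip b (Nat.zero_le _)
  have hlen : L.armIdx (flip b) (L.len (flip b).1) = L.armIdx b 0 :=
    (armIdx_flip b le_rfl).trans (congrArg _ (Nat.sub_self _))
  simp only [endpoint, armPos, hzero, hlen, mul_inv_rev, inv_inv]
  rfl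

variable [Fintype ι] {e : ι × Bool → ℝ}

/-- The mean length of an arm chosen with the probabilities `e`. -/
def meanLength (L : LoopSystem G ι) (e : ι × Bool → ℝ) : ℝ := ∑ b, e b * L.len b.1

theorem meanLength_pos (he : e ∈ stdSimplex ℝ (ι × Bool)) : 0 < L.meanLength e :=
  calc (0 : ℝ) < ∑ b, e b := he.2 ▸ one_pos
    _ ≤ L.meanLength e := Finset.sum_le_sum fun b _ =>
      le_mul_of_one_le_right (he.1 b) (Nat.one_le_cast.2 (L.len_pos b.1))

/-- The probabilities of entering the arms that make the walk traverse them with the probabilities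
`e`: an arm that has been entered is traversed with probability the inverse of its length. -/
noncomputable def lengthBiased (L : LoopSystem G ι) (e : ι × Bool → ℝ) (b : ι × Bool) : ℝ :=
  e b * L.len b.1 / L.meanLength e

theorem lengthBiased_mem_stdSimplex (L : LoopSystem G ι) (he : e ∈ stdSimplex ℝ (ι × Bool)) :
    L.lengthBiased e ∈ stdSimplex ℝ (ι × Bool) := by
  refine ⟨fun b => div_nonneg (mul_nonneg (he.1 b) (Nat.cast_nonneg _)) (meanLength_pos he).le, ?_⟩
  simp only [lengthBiased]
  rw [← Finset.sum_div]
  exact div_self (meanLength_pos he).ne'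

theorem lengthBiased_pos (he : e ∈ stdSimplex ℝ (ι × Bool)) {b : ι × Bool} (hb : 0 < e b) :
    0 < L.lengthBiased e b :=
  div_pos (mul_pos hb (Nat.cast_pos.2 (L.len_pos b.1))) (meanLength_pos he)

theorem lengthBiased_div_len (b : ι × Bool) :
    L.lengthBiased e b / L.len b.1 = e b / L.meanLength e := by
  have hlen : (L.len b.1 : ℝ) ≠ 0 := Nat.cast_ne_zero.2 (L.len_pos _).ne'
  rw [lengthBiased, div_right_comm, mul_div_cancel_right₀ _ hlen]

open Classical in
theorem linearizes_walk_lengthBiased {G : Type u} [Group G] [Countable G] [MeasurableSpace G]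
    [DiscreteMeasurableSpace G] [Nonempty ι] {L : LoopSystem G ι}
    (he : e ∈ stdSimplex ℝ (ι × Bool)) :
    (L.walk (L.lengthBiased_mem_stdSimplex he)).Linearizes
      fun g => ∑ b with L.endpoint b = g, e b := by
  refine linearizes_walk fun g => ?_
  simp only [lengthBiased_div_len]
  rw [← Finset.sum_div, ← Finset.sum_div, he.2, one_div_mul_eq_div]

open Classical in
theorem sum_endpoint_eq [Group G] (w : ι → ℝ) (c : Bool → ℝ) (g : G) :
    ∑ b with L.endpoint b = g, w b.1 * c b.2 =
      c true * ∑ i with L.endpoint (i, true) = g, w i +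
        c false * ∑ i with L.endpoint (i, true) = g⁻¹, w i := by
  have hflip : ∀ i, L.endpoint (i, false) = g ↔ L.endpoint (i, true) = g⁻¹ := fun i => by
    rw [← inv_eq_iff_eq_inv, ← endpoint_flip]
    rfl
  simp only [Finset.sum_filter, Fintype.sum_prod_type_right, Fintype.sum_bool, hflip,
    Finset.mul_sum, mul_ite, mul_zero, mul_comm]

end LengthBiased

end LoopSystem

/-! ### Loops spelled in the generators -/

section Generators

variable {G : Type*} [Group G] {S : Set G}

theorem countable_of_closure_eq_top [Countable S] (hS : Subgroup.closure S = ⊤) : Countable G :=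
  (MonoidHom.range_eq_top.1 ((FreeGroup.closure_eq_range S).symm.trans hS)).countable

theorem exists_list_prod_eq (hS_symm : ∀ g ∈ S, g⁻¹ ∈ S) (hS_gen : Subgroup.closure S = ⊤) (g : G) :
    ∃ l : List G, (∀ s ∈ l, s ∈ S) ∧ l.prod = g := by
  have hg : g ∈ Submonoid.closure (S ∪ S⁻¹) := by
    rw [← Subgroup.closure_toSubmonoid, hS_gen]
    exact Submonoid.mem_top g
  rw [Set.union_eq_self_of_subset_right fun s hs => inv_inv s ▸ hS_symm _ hs] at hg
  exact Submonoid.exists_list_of_mem_closure hg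

theorem exists_path (hS_nonempty : S.Nonempty) (hS_symm : ∀ g ∈ S, g⁻¹ ∈ S)
    (hS_gen : Subgroup.closure S = ⊤) (g : G) :
    ∃ (n : ℕ) (x : ℕ → G), 3 ≤ n ∧ x 0 = 1 ∧ x n = g ∧ ∀ j < n, (x j)⁻¹ * x (j + 1) ∈ S := by
  obtain ⟨s, hs⟩ := hS_nonempty
  obtain ⟨l, hl, hprod⟩ := exists_list_prod_eq hS_symm hS_gen (g * s * s * s)
  have hmem : ∀ t ∈ l ++ [s⁻¹, s⁻¹, s⁻¹], t ∈ S := by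
    simpa [or_imp, forall_and] using ⟨hl, hS_symm s hs⟩
  refine ⟨(l ++ [s⁻¹, s⁻¹, s⁻¹]).length, fun j => ((l ++ [s⁻¹, s⁻¹, s⁻¹]).take j).prod,
    by simp, by simp, ?_, fun j hj => ?_⟩
  · simp [hprod]
  · beta_reduce
    rw [List.prod_take_succ _ j hj, inv_mul_cancel_left]
    exact hmem _ (List.getElem_mem hj)

theorem exists_loopSystem {ι : Type*} (hS_nonempty : S.Nonempty) (hS_symm : ∀ g ∈ S, g⁻¹ ∈ S)
    (hS_gen : Subgroup.closure S = ⊤) (x : ι → G) :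
    ∃ L : LoopSystem G ι, (∀ i, L.endpoint (i, true) = x i) ∧
      ∀ i, ∀ j < L.len i, (L.pos i j)⁻¹ * L.pos i (j + 1) ∈ S := by
  choose len pos three_le_len hzero hlen hstep using
    fun i => exists_path hS_nonempty hS_symm hS_gen (x i)
  refine ⟨⟨len, three_le_len, pos⟩, fun i => ?_, hstep⟩
  change (pos i 0)⁻¹ * pos i (len i) = x i
  rw [hzero, inv_one, one_mul, hlen]

end Generators

theorem sum_support_eq {α M : Type*} [AddCommMonoid M] {f : α → M} [Fintype (Function.support f)]
    (a : α) [DecidablePred fun i : Function.support f => i.1 = a] :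
    ∑ i : Function.support f with i.1 = a, f i = f a := by
  by_cases ha : f a = 0
  · rw [ha]
    exact Finset.sum_eq_zero fun i hi => (congrArg f (Finset.mem_filter.1 hi).2).trans ha
  · rw [Finset.sum_filter,
      Fintype.sum_eq_single ⟨a, ha⟩ fun i hi => if_neg fun h => hi (Subtype.ext h), if_pos rfl]

/-- The weights `c` split the probability `p g` between the two orientations of a loop that is
spelled by a word for `g`. -/
theorem exists_linearizing_walk {G : Type u} [Group G] [MeasurableSpace G]
    [DiscreteMeasurableSpace G] {S : Set G} (hS_nonempty : S.Nonempty)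
    (hS_symm : ∀ g ∈ S, g⁻¹ ∈ S) (hS_gen : Subgroup.closure S = ⊤)
    {p : G → ℝ} (hp_nonneg : ∀ g, 0 ≤ p g) (hp_sum : HasSum p 1)
    (hp_fin : (Function.support p).Finite) (hp_gen : Subgroup.closure (Function.support p) = ⊤)
    {c : Bool → ℝ} (hc : c ∈ stdSimplex ℝ Bool) (hc_pos : 0 < c true) :
    ∃ (r : ℕ) (_ : NeZero r) (W : ColoredWalk G r),
      W.IsNearestNeighbor S ∧ W.IsQuasiIrreducible ∧
      W.Linearizes (fun g => c true * p g + c false * p g⁻¹) ∧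
      (c false = c true → W.IsReversible) := by
  classical
  have := hp_fin.fintype
  have := countable_of_closure_eq_top hp_gen
  have hsum : ∑ i : Function.support p, p i = 1 :=
    (hasSum_fintype _).unique (hasSum_subtype_support.2 hp_sum)
  have : Nonempty (Function.support p) := Finset.univ_nonempty_iff.1 <|
    Finset.nonempty_of_sum_ne_zero (f := fun i => p i) (by rw [hsum]; exact one_ne_zero)
  obtain ⟨L, hend, hstep⟩ := exists_loopSystem (ι := Function.support p) hS_nonempty hS_symm hS_gen
    Subtype.val
  let e : Function.support p × Bool → ℝ := fun b => p b.1 * c b.2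
  have he : e ∈ stdSimplex ℝ (Function.support p × Bool) :=
    ⟨fun b => mul_nonneg (hp_nonneg _) (hc.1 _), by
      simp only [e, Fintype.sum_prod_type, ← Finset.mul_sum, hc.2, mul_one, hsum]⟩
  have he_pos : ∀ i, 0 < e (i, true) := fun i =>
    mul_pos ((hp_nonneg _).lt_of_ne' i.2) hc_pos
  refine ⟨L.numColors, inferInstance, L.walk (L.lengthBiased_mem_stdSimplex he),
    LoopSystem.isNearestNeighbor_walk hS_symm hstep,
    LoopSystem.isQuasiIrreducible_walk (fun i => LoopSystem.lengthBiased_pos he (he_pos i)) ?_,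
    ?_, fun hsymm => LoopSystem.isReversible_walk ?_⟩
  · simpa only [hend, Subtype.range_coe] using hp_gen
  · have hlin := LoopSystem.linearizes_walk_lengthBiased (L := L) he
    simpa only [e, LoopSystem.sum_endpoint_eq (fun i : Function.support p => p i) c, hend,
      sum_support_eq] using hlin
  · have hc_flip : ∀ ε, c (!ε) = c ε := Bool.forall_bool.2 ⟨hsymm.symm, hsymm⟩
    simp only [LoopSystem.lengthBiased, LoopSystem.flip, e, hc_flip, implies_true]

theorem theorem1_general {G : Type u} [Group G] [MeasurableSpace G] [DiscreteMeasurableSpace G]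
    (S : Set G) (hS_nonempty : S.Nonempty) (hS_symm : ∀ g ∈ S, g⁻¹ ∈ S)
    (hS_gen : Subgroup.closure S = ⊤)
    (p : G → ℝ) (hp_nonneg : ∀ g, 0 ≤ p g) (hp_sum : HasSum p 1)
    (hp_fin : (Function.support p).Finite)
    (hp_gen : Subgroup.closure (Function.support p) = ⊤) :
    (∃ (r : ℕ) (_ : NeZero r) (W : ColoredWalk G r),
      W.IsNearestNeighbor S ∧ W.IsQuasiIrreducible ∧ W.Linearizes p) ∧
    (IsReversibleWrt (walkKernel p) (fun _ => 1) →
      ∃ (r : ℕ) (_ : NeZero r) (W : ColoredWalk G r),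
        W.IsNearestNeighbor S ∧ W.IsQuasiIrreducible ∧ W.Linearizes p ∧ W.IsReversible) := by
  have hwalk {c : Bool → ℝ} := exists_linearizing_walk (c := c) hS_nonempty hS_symm hS_gen
    hp_nonneg hp_sum hp_fin hp_gen
  refine ⟨?_, fun hrev => ?_⟩
  · obtain ⟨r, hr, W, hnn, hqi, hlin, -⟩ := hwalk (single_mem_stdSimplex ℝ true) (by simp)
    exact ⟨r, hr, W, hnn, hqi, by simpa using hlin⟩
  · have hp_inv : ∀ g, p g⁻¹ = p g := fun g => by simpa [walkKernel] using hrev g 1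
    have hhalf : (fun _ => 1 / 2) ∈ stdSimplex ℝ Bool := ⟨fun _ => one_half_pos.le, by norm_num⟩
    obtain ⟨r, hr, W, hnn, hqi, hlin, hW⟩ := hwalk hhalf one_half_pos
    refine ⟨r, hr, W, hnn, hqi, ?_, hW rfl⟩
    simpa only [hp_inv, ← add_mul, add_halves, one_mul] using hlin

theorem theorem1 {G : Type u} [Group G] [MeasurableSpace G] [DiscreteMeasurableSpace G]
    (S : Finset G) (hS_nonempty : S.Nonempty) (hS_symm : ∀ g ∈ S, g⁻¹ ∈ S)
    (hS_gen : Subgroup.closure (S : Set G) = ⊤)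
    (p : G → ℝ) (hp_nonneg : ∀ g, 0 ≤ p g) (hp_sum : HasSum p 1)
    (hp_fin : (Function.support p).Finite)
    (hp_gen : Subgroup.closure (Function.support p) = ⊤) :
    (∃ (r : ℕ) (_ : NeZero r) (W : ColoredWalk G r),
      W.IsNearestNeighbor S ∧ W.IsQuasiIrreducible ∧ W.Linearizes p) ∧
    (IsReversibleWrt (walkKernel p) (fun _ => 1) →
      ∃ (r : ℕ) (_ : NeZero r) (W : ColoredWalk G r),
        W.IsNearestNeighbor S ∧ W.IsQuasiIrreducible ∧ W.Linearizes p ∧ W.IsReversible) :=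
  theorem1_general (S : Set G) hS_nonempty hS_symm hS_gen p hp_nonneg hp_sum hp_fin hp_gen
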